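/- Let $-\infty<l<r<\infty$, $\rho\in(0,\infty)$, and let $\mu\in C^3([l,r])$, $\sigma^2\in C^4([l,r])$ with $\sigma^2>0$ on $[l,r]$, and $\kappa\in C^2([l,r])$ with $\kappa\ge 0$ on $[l,r]$ (real-valued, derivatives at the end points one-sided). Put $$s(x)=\exp\Big(-\int_l^x\frac{2\mu(y)}{\sigma^2(y)}\,dy\Big),\qquad (f,g)=\frac1\rho f(l)g(l)+\int_l^r \frac{2f(x)g(x)}{\sigma^2(x)s(x)}\,dx ,$$ and consider the Sturm–Liouville problem for the generator of the diffusion on $[l,r)$ that is sticky at $l$ and killed at rate $\kappa$ and at $r$: find $\lambda\in\mathbb R$ and $\varphi\in C^2([l,r])$, $\varphi\not\equiv0$, with $$\tfrac12\sigma^2(x)\varphi''(x)+\mu(x)\varphi'(x)-\kappa(x)\varphi(x)=-\lambda\varphi(x)\quad (l<x<r),$$ $$\rho\,\varphi'(l)-(\kappa(l)-\lambda)\varphi(l)=0,\qquad \varphi(r)=0 .$$ Then the eigenvalues are simple and form a sequence $\lambda_1<\lambda_2<\cdots$. Let $\varphi_k$ denote any eigenfunction of $\lambda_k$ normalized by $(\varphi_k,\varphi_k)=1$.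 Then $\varphi_k\in C^4([l,r])$, and there are constants $C_1,C_2,C_3>0$, independent of $k$ and of the choice of $\varphi_k$, such that for all $k=1,2,\dots$ $$C_1k^2\le\lambda_k\le C_2k^2,\qquad \|\varphi_k^{(i)}\|_\infty=\sup_{x\in[l,r]}|\varphi_k^{(i)}(x)|\le C_3k^i\quad (i=0,1,\dots,4).$$ -/

import Mathlib

open Set

noncomputable section

/-- The density `s` of the scale measure of a diffusion with drift `μ` and volatility `σ`:
`s(x) = exp (-∫_l^x 2 μ(y) / σ²(y) dy)`. -/
def scaleDensity (l : ℝ) (μ σ : ℝ → ℝ) (x : ℝ) : ℝ :=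
  Real.exp (-∫ y in l..x, 2 * μ y / σ y ^ 2)

/-- The density `m` of the absolutely continuous part of the speed measure
`M(dx) = m(x) dx + (1/ρ) δ_l(dx)`: `m(x) = 2 / (σ²(x) s(x))`. -/
def speedDensity (l : ℝ) (μ σ : ℝ → ℝ) (x : ℝ) : ℝ :=
  2 / (σ x ^ 2 * scaleDensity l μ σ x)

/-- The inner product of `L²(M)`, with `M` the (mixed) speed measure of the sticky diffusion on
`[l, r)`: `(f, g) = (1/ρ) f(l) g(l) + ∫_l^r f(x) g(x) m(x) dx`. -/
def speedInner (l r ρ : ℝ) (μ σ f g : ℝ → ℝ) : ℝ :=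
  1 / ρ * f l * g l + ∫ x in l..r, f x * g x * speedDensity l μ σ x

/-- The generator of the diffusion on `[l, r)` that is sticky at `l` with stickiness `ρ` and killed
at rate `κ`:
`𝒢f(x) = (μ(x) 1_{x>l} + ρ 1_{x=l}) f'(x) + (1/2) σ²(x) 1_{x>l} f''(x) - κ(x) f(x)`.
Derivatives are taken within `[l, r]`: they are the usual ones inside, one-sided at the ends. -/
def stickyGenerator (l r ρ : ℝ) (μ σ κ f : ℝ → ℝ) (x : ℝ) : ℝ :=
  ((if l < x then μ x else 0) + (if x = l then ρ else 0)) * derivWithin f (Icc l r) x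
    + 1 / 2 * (if l < x then σ x ^ 2 else 0) * iteratedDerivWithin 2 f (Icc l r) x
    - κ x * f x

/-- `φ` solves the Sturm–Liouville problem with eigenparameter `lam` (`φ = 0` is not excluded):
`𝒢φ = -lam φ` on `(l, r)`, `ρ φ'(l) - (κ(l) - lam) φ(l) = 0` and `φ(r) = 0`. Only the values
of `φ` on `[l, r]` matter. -/
structure SolvesStickySL (l r ρ : ℝ) (μ σ κ : ℝ → ℝ) (lam : ℝ) (φ : ℝ → ℝ) : Prop where
  contDiffOn : ContDiffOn ℝ 2 φ (Icc l r)
  eigen_eq : ∀ x ∈ Ioo l r, stickyGenerator l r ρ μ σ κ φ x = -lam * φ x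
  left_bc : ρ * derivWithin φ (Icc l r) l - (κ l - lam) * φ l = 0
  right_bc : φ r = 0

/-- `φ` is an eigenfunction: a solution that does not vanish identically on `[l, r]`. -/
def IsStickyEigenfunction (l r ρ : ℝ) (μ σ κ : ℝ → ℝ) (lam : ℝ) (φ : ℝ → ℝ) : Prop :=
  SolvesStickySL l r ρ μ σ κ lam φ ∧ ∃ x ∈ Icc l r, φ x ≠ 0

/-- The set of eigenvalues of the Sturm–Liouville problem. -/
def stickyEigenvalues (l r ρ : ℝ) (μ σ κ : ℝ → ℝ) : Set ℝ :=
  {lam | ∃ φ : ℝ → ℝ, IsStickyEigenfunction l r ρ μ σ κ lam φ}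

end

/-! With `u = φ` and `v = φ'/s` the equation becomes the system `u' = s v`, `v' = (κ - λ) m u`,
where `m` is the speed density. In Prüfer coordinates `u = R sin θ`, `v = R cos θ`, the angle obeys
a scalar equation of its own and `R > 0` a linear one. The sticky condition fixes `θ(l)` in `(0, π)`
as an increasing function of `λ`, so every solution is a multiple of `R sin θ`. This gives
simplicity, and `λ` is an eigenvalue exactly when `θ(r)` is a multiple of `π`.

At `r` the angle is positive, continuous and strictly increasing in `λ`, at most `π/2` for `λ = 0`,
and unbounded as `λ → ∞`. It therefore takes each value `kπ`, `k ≥ 1`, exactly once, at some `λ_k >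
0` (`IsPruferAngle.exists_spectrum`). Replacing `tan θ` by `√λ tan θ` moves the angle by at most
`π/2` and gives it speed of order `√λ`; hence `λ_k` is of order `k²`.

For the eigenfunctions, the energy `λ φ² + σ² φ'²/2` has logarithmic derivative bounded
independently of `λ`, so its maximum is comparable to its average, which the normalization bounds by
a multiple of `λ` (`exists_energy_bound`). Thus `φ = O(1)` and `φ' = O(√λ) = O(k)`. The equation and
its first two derivatives then bound the orders 2 to 4 (`exists_derivative_bounds`). -/

/-! ### Scalar linear equations and comparison on a closed interval -/

theorem exists_antideriv_Icc {l r : ℝ} (hlr : l ≤ r) {g : ℝ → ℝ} (hg : ContinuousOn g (Icc l r)) :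
    ∃ G : ℝ → ℝ, (∀ x ∈ Icc l r, G x = ∫ y in l..x, g y) ∧
      ∀ x ∈ Icc l r, HasDerivWithinAt G (g x) (Icc l r) x := by
  -- The constant extension beyond the end points is continuous on `ℝ`, so the fundamental theorem
  -- of calculus also covers the end points.
  have hc : Continuous (IccExtend hlr ((Icc l r).domRestrict g)) :=
    (continuousOn_iff_continuous_domRestrict.1 hg).Icc_extend'
  have he : ∀ x ∈ Icc l r, IccExtend hlr ((Icc l r).domRestrict g) x = g x := fun x hx => by
    rw [IccExtend_of_mem _ _ hx]; rfl
  refine ⟨fun x => ∫ y in l..x, IccExtend hlr ((Icc l r).domRestrict g) y, fun x hx => ?_,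
    fun x hx => ?_⟩
  · refine intervalIntegral.integral_congr fun y hy => he y ?_
    rw [uIcc_of_le hx.1] at hy
    exact ⟨hy.1, hy.2.trans hx.2⟩
  · rw [← he x hx]
    exact (hc.integral_hasStrictDerivAt l x).hasDerivAt.hasDerivWithinAt

theorem exists_pos_linear_solution {l r : ℝ} (hlr : l ≤ r) {g : ℝ → ℝ}
    (hg : ContinuousOn g (Icc l r)) :
    ∃ w : ℝ → ℝ, w l = 1 ∧ (∀ x, 0 < w x) ∧
      ∀ x ∈ Icc l r, HasDerivWithinAt w (g x * w x) (Icc l r) x := by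
  obtain ⟨G, hG, hG'⟩ := exists_antideriv_Icc hlr hg
  refine ⟨fun x => Real.exp (G x), ?_, fun x => Real.exp_pos _, fun x hx => ?_⟩
  · simp [hG l (left_mem_Icc.2 hlr)]
  · have := (hG' x hx).exp
    rwa [mul_comm]

theorem monotoneOn_Icc_of_hasDerivWithinAt {l r : ℝ} {f f' : ℝ → ℝ}
    (hf : ∀ x ∈ Icc l r, HasDerivWithinAt f (f' x) (Icc l r) x)
    (hf' : ∀ x ∈ Icc l r, 0 ≤ f' x) : MonotoneOn f (Icc l r) :=
  monotoneOn_of_hasDerivWithinAt_nonneg (convex_Icc l r)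
    (fun x hx => (hf x hx).continuousWithinAt)
    (fun x hx => (hf x (interior_subset hx)).mono interior_subset)
    (fun x hx => hf' x (interior_subset hx))

/-- The quotient `y / w` has derivative `c / w ≥ 0`. -/
theorem linear_comparison {l r : ℝ} {w y g c : ℝ → ℝ}
    (hw : ∀ x, 0 < w x) (hw1 : w l = 1)
    (hw' : ∀ x ∈ Icc l r, HasDerivWithinAt w (g x * w x) (Icc l r) x)
    (hy : ∀ x ∈ Icc l r, HasDerivWithinAt y (c x + g x * y x) (Icc l r) x)
    (hc : ∀ x ∈ Icc l r, 0 ≤ c x) : ∀ x ∈ Icc l r, y l * w x ≤ y x := by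
  intro x hx
  have hm : MonotoneOn (fun x => y x / w x) (Icc l r) := by
    refine monotoneOn_Icc_of_hasDerivWithinAt (f' := fun x => c x / w x) (fun x hx => ?_)
      fun x hx => div_nonneg (hc x hx) (hw x).le
    convert! (hy x hx).div (hw' x hx) (hw x).ne' using 1
    field_simp [(hw x).ne']
    ring
  have := hm (left_mem_Icc.2 (hx.1.trans hx.2)) hx hx.1
  simp only [hw1, div_one] at this
  rwa [le_div_iff₀ (hw x)] at this

theorem linear_solution_unique {l r : ℝ} {w y g : ℝ → ℝ}
    (hw : ∀ x, 0 < w x) (hw1 : w l = 1)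
    (hw' : ∀ x ∈ Icc l r, HasDerivWithinAt w (g x * w x) (Icc l r) x)
    (hy : ∀ x ∈ Icc l r, HasDerivWithinAt y (g x * y x) (Icc l r) x) :
    ∀ x ∈ Icc l r, y x = y l * w x := by
  intro x hx
  have h1 := linear_comparison (c := 0) hw hw1 hw' (fun x hx => by simpa using hy x hx)
    (fun _ _ => le_rfl) x hx
  have h2 := linear_comparison (c := 0) (y := fun x => - y x) hw hw1 hw'
    (fun x hx => by simpa using (hy x hx).fun_neg)
    (fun _ _ => le_rfl) x hx
  linarith

theorem linear_comparison_pos {l r : ℝ} (hlr : l ≤ r) {y g c : ℝ → ℝ}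
    (hg : ContinuousOn g (Icc l r))
    (hy : ∀ x ∈ Icc l r, HasDerivWithinAt y (c x + g x * y x) (Icc l r) x)
    (hc : ∀ x ∈ Icc l r, 0 ≤ c x) (h0 : 0 < y l) : ∀ x ∈ Icc l r, 0 < y x := by
  obtain ⟨w, hw1, hw, hw'⟩ := exists_pos_linear_solution hlr hg
  exact fun x hx => (mul_pos h0 (hw x)).trans_le (linear_comparison hw hw1 hw' hy hc x hx)

theorem linear_comparison_nonneg {l r : ℝ} (hlr : l ≤ r) {y g c : ℝ → ℝ}
    (hg : ContinuousOn g (Icc l r))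
    (hy : ∀ x ∈ Icc l r, HasDerivWithinAt y (c x + g x * y x) (Icc l r) x)
    (hc : ∀ x ∈ Icc l r, 0 ≤ c x) (h0 : 0 ≤ y l) : ∀ x ∈ Icc l r, 0 ≤ y x := by
  obtain ⟨w, hw1, hw, hw'⟩ := exists_pos_linear_solution hlr hg
  exact fun x hx => (mul_nonneg h0 (hw x).le).trans (linear_comparison hw hw1 hw' hy hc x hx)

/-- A positive function with `|E'| ≤ C E` varies by a bounded factor. -/
theorem le_exp_mul_of_abs_deriv_le {l r C : ℝ} {E E' : ℝ → ℝ}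
    (hE : ∀ x ∈ Icc l r, HasDerivWithinAt E (E' x) (Icc l r) x)
    (hE' : ∀ x ∈ Icc l r, |E' x| ≤ C * E x) (hpos : ∀ x ∈ Icc l r, 0 ≤ E x) (hC : 0 ≤ C) :
    ∀ x ∈ Icc l r, ∀ y ∈ Icc l r, E x ≤ Real.exp (C * (r - l)) * E y := by
  have hexp : ∀ (a x : ℝ), HasDerivWithinAt (fun t => Real.exp (a * t)) (Real.exp (a * x) * a)
      (Icc l r) x := fun a x => by
    simpa using ((hasDerivWithinAt_id x (Icc l r)).const_mul a).exp
  have key : ∀ a x y, E x * Real.exp a ≤ E y * Real.exp (a + C * (r - l)) →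
      E x ≤ Real.exp (C * (r - l)) * E y := fun a x y h => by
    rw [Real.exp_add] at h
    have := Real.exp_pos a
    nlinarith
  intro x hx y hy
  rcases le_total x y with h | h
  · have hm : MonotoneOn (fun t => E t * Real.exp (C * t)) (Icc l r) := by
      refine monotoneOn_Icc_of_hasDerivWithinAt (fun t ht => (hE t ht).mul (hexp C t)) ?_
      intro t ht
      have := (abs_le.1 (hE' t ht)).1
      have := Real.exp_pos (C * t)
      nlinarith
    have h1 := hm hx hy h
    refine key (C * x) x y (h1.trans ?_)
    refine mul_le_mul_of_nonneg_left (Real.exp_le_exp.2 ?_) (hpos y hy)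
    nlinarith [hx.1, hy.2]
  · have hm : MonotoneOn (fun t => -(E t * Real.exp (-C * t))) (Icc l r) := by
      refine monotoneOn_Icc_of_hasDerivWithinAt (fun t ht => ((hE t ht).mul (hexp (-C) t)).neg) ?_
      intro t ht
      have := (abs_le.1 (hE' t ht)).2
      have := Real.exp_pos (-C * t)
      nlinarith
    have h1 := neg_le_neg_iff.1 (hm hy hx h)
    refine key (-C * x) x y (h1.trans ?_)
    refine mul_le_mul_of_nonneg_left (Real.exp_le_exp.2 ?_) (hpos y hy)
    nlinarith [hx.2, hy.1]

/-! ### One-sided derivatives and compactness bounds -/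

theorem iteratedDerivWithin_eqOn_of_hasDerivWithinAt {s : Set ℝ} (hs : UniqueDiffOn ℝ s) (n : ℕ)
    {F : ℕ → ℝ → ℝ}
    (hF : ∀ i < n, ∀ x ∈ s, HasDerivWithinAt (F i) (F (i + 1) x) s x) :
    ∀ i ≤ n, EqOn (iteratedDerivWithin i (F 0) s) (F i) s := by
  intro i
  induction i with
  | zero => intro _ x _; simp
  | succ i ih =>
    intro hi x hx
    rw [iteratedDerivWithin_succ, derivWithin_congr (ih (by omega)) (ih (by omega) hx)]
    exact (hF i hi x hx).derivWithin (hs x hx)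

theorem contDiffOn_of_hasDerivWithinAt_chain {s : Set ℝ} (hs : UniqueDiffOn ℝ s) (n : ℕ)
    {F : ℕ → ℝ → ℝ}
    (hF : ∀ i < n, ∀ x ∈ s, HasDerivWithinAt (F i) (F (i + 1) x) s x)
    (hFc : ContinuousOn (F n) s) : ContDiffOn ℝ n (F 0) s := by
  have he := iteratedDerivWithin_eqOn_of_hasDerivWithinAt hs n hF
  rw [contDiffOn_nat_iff_continuousOn_differentiableOn_deriv hs]
  have hd : ∀ m < n, DifferentiableOn ℝ (F m) s := fun m hm x hx =>
    (hF m hm x hx).differentiableWithinAt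
  refine ⟨fun m hm => ?_, fun m hm => (hd m hm).congr (he m hm.le)⟩
  rcases hm.lt_or_eq with h | rfl
  · exact (hd m h).continuousOn.congr (he m hm)
  · exact hFc.congr (he m hm)

theorem ContDiffOn.hasDerivWithinAt_iteratedDerivWithin {s : Set ℝ} (hs : UniqueDiffOn ℝ s) {n : ℕ}
    {f : ℝ → ℝ} (hf : ContDiffOn ℝ n f s) {i : ℕ} (hi : i < n) {x : ℝ} (hx : x ∈ s) :
    HasDerivWithinAt (iteratedDerivWithin i f s) (iteratedDerivWithin (i + 1) f s x) s x := by
  have := ((contDiffOn_nat_iff_continuousOn_differentiableOn_deriv hs).1 hf).2 i hi x hx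
  rw [iteratedDerivWithin_succ]
  exact this.hasDerivWithinAt

theorem ContinuousOn.exists_pos_abs_bound {l r : ℝ} {f : ℝ → ℝ}
    (hf : ContinuousOn f (Icc l r)) : ∃ M > 0, ∀ x ∈ Icc l r, |f x| ≤ M := by
  obtain ⟨M, hM⟩ := isCompact_Icc.exists_bound_of_continuousOn hf
  exact ⟨max M 1, by positivity, fun x hx => (hM x hx).trans (le_max_left _ _)⟩

theorem ContinuousOn.exists_pos_lower_bound {l r : ℝ} (hlr : l ≤ r) {f : ℝ → ℝ}
    (hf : ContinuousOn f (Icc l r)) (hpos : ∀ x ∈ Icc l r, 0 < f x) :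
    ∃ c > 0, ∀ x ∈ Icc l r, c ≤ f x := by
  obtain ⟨a, ha, h⟩ := isCompact_Icc.exists_isMinOn (nonempty_Icc.2 hlr) hf
  exact ⟨f a, hpos a ha, fun x hx => h hx⟩

/-! ### The Prüfer angle and its dependence on the eigenparameter -/

theorem Real.sinc_mul_self (x : ℝ) : Real.sinc x * x = Real.sin x := by
  by_cases h : x = 0
  · simp [h]
  · rw [Real.sinc_of_ne_zero h, div_mul_cancel₀ _ h]

theorem Real.sin_sq_sub_sin_sq (a b : ℝ) :
    Real.sin a ^ 2 - Real.sin b ^ 2 = Real.sin (a - b) * Real.sin (a + b) := by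
  rw [Real.sin_sub, Real.sin_add]
  linear_combination (-Real.sin a ^ 2) * Real.sin_sq_add_cos_sq b +
    Real.sin b ^ 2 * Real.sin_sq_add_cos_sq a

/-- `θ` is the Prüfer angle of the system `u' = s v`, `v' = (κ - lam) m u` with initial values
proportional to `u = ρ`, `v = κ - lam` at `l`; that is, `u = R sin θ` and `v = R cos θ`. -/
structure IsPruferAngle (l r ρ : ℝ) (s m κ : ℝ → ℝ) (lam : ℝ) (θ : ℝ → ℝ) : Prop where
  init : θ l = Real.pi / 2 + Real.arctan ((lam - κ l) / ρ)
  deriv : ∀ x ∈ Icc l r, HasDerivWithinAt θ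
    (s x * Real.cos (θ x) ^ 2 + (lam - κ x) * m x * Real.sin (θ x) ^ 2) (Icc l r) x

namespace IsPruferAngle

variable {l r ρ : ℝ} {s m κ : ℝ → ℝ} {lam : ℝ} {θ : ℝ → ℝ}

theorem continuousOn (h : IsPruferAngle l r ρ s m κ lam θ) : ContinuousOn θ (Icc l r) :=
  fun x hx => (h.deriv x hx).continuousWithinAt

/-- The right side is bounded and Lipschitz in the angle, uniformly on `[l, r]`, so a single
application of Picard–Lindelöf covers the whole interval. -/
theorem exists_angle (hlr : l ≤ r) (hs : ContinuousOn s (Icc l r)) (hm : ContinuousOn m (Icc l r))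
    (hκ : ContinuousOn κ (Icc l r)) (lam : ℝ) : ∃ θ, IsPruferAngle l r ρ s m κ lam θ := by
  obtain ⟨A, hA, hA'⟩ := hs.exists_pos_abs_bound
  have hq : ContinuousOn (fun x => (lam - κ x) * m x) (Icc l r) :=
    (continuousOn_const.sub hκ).mul hm
  obtain ⟨B, hB, hB'⟩ := hq.exists_pos_abs_bound
  set f : ℝ → ℝ → ℝ := fun x t => s x * Real.cos t ^ 2 + (lam - κ x) * m x * Real.sin t ^ 2 with hf
  have hbd : ∀ x ∈ Icc l r, ∀ t, |f x t| ≤ A + B := fun x hx t => by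
    have h1 := abs_le.1 (hA' x hx)
    have h2 := abs_le.1 (hB' x hx)
    have h3 := Real.sin_sq_le_one t
    have h4 := Real.cos_sq_le_one t
    have h5 := sq_nonneg (Real.sin t)
    have h6 := sq_nonneg (Real.cos t)
    rw [abs_le]
    constructor <;> simp only [hf] <;> nlinarith
  have hpl : IsPicardLindelof f (⟨l, left_mem_Icc.2 hlr⟩ : Icc l r)
      (Real.pi / 2 + Real.arctan ((lam - κ l) / ρ))
      (Real.toNNReal ((A + B) * (r - l))) 0 (Real.toNNReal (A + B)) (Real.toNNReal (A + B)) := by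
    refine ⟨fun x hx => ?_, fun t _ => ?_, fun x hx t _ => ?_, ?_⟩
    · refine (LipschitzWith.of_dist_le_mul fun a b => ?_).lipschitzOnWith
      rw [Real.coe_toNNReal _ (by positivity), Real.dist_eq, Real.dist_eq]
      have : f x a - f x b =
          ((lam - κ x) * m x - s x) * (Real.sin (a - b) * Real.sin (a + b)) := by
        rw [← Real.sin_sq_sub_sin_sq]
        simp only [hf, Real.cos_sq']
        ring
      rw [this, abs_mul, abs_mul]
      have h1 : |(lam - κ x) * m x - s x| ≤ A + B :=
        (abs_sub _ _).trans (by linarith [hA' x hx, hB' x hx])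
      have h2 : |Real.sin (a - b)| * |Real.sin (a + b)| ≤ |a - b| * 1 :=
        mul_le_mul Real.abs_sin_le_abs (Real.abs_sin_le_one _) (abs_nonneg _) (abs_nonneg _)
      rw [mul_one] at h2
      exact mul_le_mul h1 h2 (by positivity) (by positivity)
    · exact (hs.mul continuousOn_const).add (hq.mul continuousOn_const)
    · rw [Real.coe_toNNReal _ (by positivity)]
      exact hbd x hx t
    · have : 0 ≤ r - l := by linarith
      rw [Real.coe_toNNReal _ (by positivity), Real.coe_toNNReal _ (by positivity)]
      simp [this]
  obtain ⟨θ, h0, h1⟩ := hpl.exists_eq_forall_mem_Icc_hasDerivWithinAt₀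
  exact ⟨θ, h0, h1⟩

/-- Since `sin² a - sin² b = sin (a - b) sin (a + b)` and `sin d = sinc d · d`, the difference of
two angles solves a linear equation with continuous coefficient. Its forcing term has the sign of
`lam' - lam` when `m` is positive, so linear comparison applies. -/
theorem hasDerivWithinAt_sub {lam' : ℝ} {θ' : ℝ → ℝ} (h : IsPruferAngle l r ρ s m κ lam θ)
    (h' : IsPruferAngle l r ρ s m κ lam' θ') : ∀ x ∈ Icc l r,
      HasDerivWithinAt (fun x => θ' x - θ x) ((lam' - lam) * (m x * Real.sin (θ' x) ^ 2) +
        ((lam - κ x) * m x - s x) * Real.sin (θ' x + θ x) * Real.sinc (θ' x - θ x) *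
          (θ' x - θ x)) (Icc l r) x := by
  intro x hx
  refine ((h'.deriv x hx).sub (h.deriv x hx)).congr_deriv ?_
  rw [mul_assoc _ (Real.sinc _), Real.sinc_mul_self, mul_assoc _ (Real.sin _),
    mul_comm (Real.sin (θ' x + θ x)), ← Real.sin_sq_sub_sin_sq]
  simp only [Real.cos_sq']
  ring

theorem lt_of_lt (hlr : l ≤ r) (hρ : 0 < ρ)
    (hs : ContinuousOn s (Icc l r)) (hm : ContinuousOn m (Icc l r))
    (hκ : ContinuousOn κ (Icc l r)) (hmpos : ∀ x ∈ Icc l r, 0 < m x)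
    {lam' : ℝ} {θ' : ℝ → ℝ} (h : IsPruferAngle l r ρ s m κ lam θ)
    (h' : IsPruferAngle l r ρ s m κ lam' θ') (hlam : lam < lam') : ∀ x ∈ Icc l r, θ x < θ' x := by
  have hg : ContinuousOn (fun x => ((lam - κ x) * m x - s x) * Real.sin (θ' x + θ x) *
      Real.sinc (θ' x - θ x)) (Icc l r) :=
    ((((continuousOn_const.sub hκ).mul hm).sub hs).mul
      (Real.continuous_sin.comp_continuousOn (h'.continuousOn.add h.continuousOn))).mul
      (Real.continuous_sinc.comp_continuousOn (h'.continuousOn.sub h.continuousOn))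
  have := linear_comparison_pos hlr hg (h.hasDerivWithinAt_sub h')
    (fun x hx => mul_nonneg (sub_nonneg.2 hlam.le) (mul_nonneg (hmpos x hx).le (sq_nonneg _))) (by
      rw [h.init, h'.init]
      have : Real.arctan ((lam - κ l) / ρ) < Real.arctan ((lam' - κ l) / ρ) :=
        Real.arctan_strictMono (by gcongr)
      linarith)
  exact fun x hx => sub_pos.1 (this x hx)

/-- The same `sinc` device turns the equation for `θ` itself into a linear one with forcing `s cos²
θ ≥ 0`. -/
theorem pos (hlr : l ≤ r) (hm : ContinuousOn m (Icc l r))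
    (hκ : ContinuousOn κ (Icc l r)) (hspos : ∀ x ∈ Icc l r, 0 < s x)
    (h : IsPruferAngle l r ρ s m κ lam θ) : ∀ x ∈ Icc l r, 0 < θ x := by
  have hθ := h.continuousOn
  have hg : ContinuousOn (fun x => (lam - κ x) * m x * Real.sin (θ x) * Real.sinc (θ x))
      (Icc l r) :=
    ((((continuousOn_const.sub hκ).mul hm)).mul (Real.continuous_sin.comp_continuousOn hθ)).mul
      (Real.continuous_sinc.comp_continuousOn hθ)
  refine linear_comparison_pos hlr hg (c := fun x => s x * Real.cos (θ x) ^ 2) (fun x hx => ?_)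
    (fun x hx => mul_nonneg (hspos x hx).le (sq_nonneg _)) ?_
  · refine (h.deriv x hx).congr_deriv ?_
    rw [mul_assoc _ (Real.sinc _), Real.sinc_mul_self]
    ring
  · rw [h.init]
    linarith [Real.neg_pi_div_two_lt_arctan ((lam - κ l) / ρ)]

/-- For `lam = 0` the gap `π/2 - θ` solves a linear equation with forcing `κ m sin² θ ≥ 0`. This
keeps every eigenvalue strictly positive. -/
theorem le_pi_div_two (hlr : l ≤ r) (hρ : 0 < ρ) (hs : ContinuousOn s (Icc l r))
    (hmpos : ∀ x ∈ Icc l r, 0 < m x) (hκ0 : ∀ x ∈ Icc l r, 0 ≤ κ x)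
    (h : IsPruferAngle l r ρ s m κ 0 θ) : ∀ x ∈ Icc l r, θ x ≤ Real.pi / 2 := by
  have hθ := h.continuousOn
  have hδ : ContinuousOn (fun x => Real.pi / 2 - θ x) (Icc l r) := continuousOn_const.sub hθ
  have hg : ContinuousOn (fun x => -(s x * Real.cos (θ x)) * Real.sinc (Real.pi / 2 - θ x))
      (Icc l r) :=
    ((hs.mul (Real.continuous_cos.comp_continuousOn hθ)).neg).mul
      (Real.continuous_sinc.comp_continuousOn hδ)
  have := linear_comparison_nonneg hlr hg (y := fun x => Real.pi / 2 - θ x)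
    (c := fun x => κ x * m x * Real.sin (θ x) ^ 2) (fun x hx => ?_)
    (fun x hx => mul_nonneg (mul_nonneg (hκ0 x hx) (hmpos x hx).le) (sq_nonneg _)) ?_
  · exact fun x hx => sub_nonneg.1 (this x hx)
  · refine ((h.deriv x hx).const_sub (Real.pi / 2)).congr_deriv ?_
    rw [mul_assoc _ (Real.sinc _), Real.sinc_mul_self, Real.sin_pi_div_two_sub]
    ring
  · have : Real.arctan ((0 - κ l) / ρ) ≤ 0 := by
      refine (Real.arctan_strictMono.monotone ?_).trans_eq Real.arctan_zero
      exact div_nonpos_of_nonpos_of_nonneg (by linarith [hκ0 l (left_mem_Icc.2 hlr)]) hρ.le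
    rw [h.init]
    linarith

end IsPruferAngle

theorem Real.abs_arctan_sub_arctan_le (a b : ℝ) : |Real.arctan a - Real.arctan b| ≤ |a - b| := by
  have : LipschitzWith 1 Real.arctan := by
    refine lipschitzWith_of_nnnorm_deriv_le Real.differentiable_arctan fun x => ?_
    rw [← NNReal.coe_le_coe, coe_nnnorm, Real.deriv_arctan, Real.norm_eq_abs, NNReal.coe_one,
      abs_of_nonneg (by positivity)]
    exact div_le_one_of_le₀ (by nlinarith) (by positivity)
  simpa [Real.dist_eq] using this.dist_le_mul a b

/-- Grönwall for the difference of two angles. Its linear coefficient is bounded in terms of `lam`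
alone because `sin` and `sinc` are at most 1, so the estimate is uniform in `lam'`. -/
theorem IsPruferAngle.continuous_right {l r ρ : ℝ} {s m κ : ℝ → ℝ} (hlr : l ≤ r) (hρ : 0 < ρ)
    (hs : ContinuousOn s (Icc l r)) (hm : ContinuousOn m (Icc l r))
    (hκ : ContinuousOn κ (Icc l r)) {Θ : ℝ → ℝ → ℝ}
    (hΘ : ∀ lam, IsPruferAngle l r ρ s m κ lam (Θ lam)) : Continuous fun lam => Θ lam r := by
  refine continuous_iff_continuousAt.2 fun lam => ?_
  have hq : ContinuousOn (fun x => (lam - κ x) * m x - s x) (Icc l r) :=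
    ((continuousOn_const.sub hκ).mul hm).sub hs
  obtain ⟨K, hK, hK'⟩ := hq.exists_pos_abs_bound
  obtain ⟨M, hM, hM'⟩ := hm.exists_pos_abs_bound
  have key : ∀ lam', |Θ lam' r - Θ lam r| ≤
      gronwallBound (|lam' - lam| / ρ) K (|lam' - lam| * M) (r - l) := fun lam' => by
    have hd := (hΘ lam).hasDerivWithinAt_sub (hΘ lam')
    refine norm_le_gronwallBound_of_norm_deriv_right_le
      (f := fun x => Θ lam' x - Θ lam x) (fun x hx => (hd x hx).continuousWithinAt)
      (fun x hx => (hd x (Ico_subset_Icc_self hx)).mono_of_mem_nhdsWithin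
        (Icc_mem_nhdsGE_of_mem hx)) ?_ (fun x hx => ?_) r (right_mem_Icc.2 hlr)
    · rw [(hΘ lam).init, (hΘ lam').init, Real.norm_eq_abs]
      have := Real.abs_arctan_sub_arctan_le ((lam' - κ l) / ρ) ((lam - κ l) / ρ)
      rw [← sub_div, abs_div, abs_of_pos hρ] at this
      simpa using this
    · have hx' := Ico_subset_Icc_self hx
      simp only [Real.norm_eq_abs]
      refine (abs_add_le _ _).trans ?_
      rw [add_comm]
      refine add_le_add ?_ ?_
      · rw [abs_mul]
        refine mul_le_mul_of_nonneg_right ?_ (abs_nonneg _)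
        rw [abs_mul, abs_mul]
        have h1 := hK' x hx'
        have h2 := Real.abs_sin_le_one (Θ lam' x + Θ lam x)
        have h3 := Real.abs_sinc_le_one (Θ lam' x - Θ lam x)
        calc _ ≤ K * 1 * 1 := by gcongr
          _ = K := by ring
      · rw [abs_mul, abs_mul]
        have h1 := hM' x hx'
        have h2 := Real.sin_sq_le_one (Θ lam' x)
        rw [abs_of_nonneg (sq_nonneg (Real.sin (Θ lam' x)))]
        calc _ ≤ |lam' - lam| * (M * 1) := by gcongr
          _ = |lam' - lam| * M := by ring
  refine tendsto_iff_dist_tendsto_zero.2 (squeeze_zero (fun _ => dist_nonneg) key ?_)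
  simp only [gronwallBound_of_K_ne_0 hK.ne']
  have : Continuous fun lam' => |lam' - lam| / ρ * Real.exp (K * (r - l)) +
      |lam' - lam| * M / K * (Real.exp (K * (r - l)) - 1) := by fun_prop
  simpa using this.tendsto lam

/-! ### Growth of the angle like the square root of the eigenparameter -/

/-- The rescaled Prüfer angle: the continuous branch `T` of `tan T = w tan t` with `T = t` at the
multiples of `π / 2`. -/
noncomputable def scaledAngle (w t : ℝ) : ℝ :=
  t + Real.arctan ((w - 1) * (Real.sin t * Real.cos t) / (Real.cos t ^ 2 + w * Real.sin t ^ 2))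

theorem Real.cos_sq_add_mul_sin_sq_pos {w : ℝ} (hw : 0 < w) (t : ℝ) :
    0 < Real.cos t ^ 2 + w * Real.sin t ^ 2 := by
  rcases (sq_nonneg (Real.sin t)).lt_or_eq with h | h
  · have := sq_nonneg (Real.cos t)
    have := mul_pos hw h
    linarith
  · have := Real.sin_sq_add_cos_sq t
    rw [← h] at this ⊢
    linarith

theorem hasDerivAt_scaledAngle {w : ℝ} (hw : 0 < w) (t : ℝ) :
    HasDerivAt (scaledAngle w) (w / (Real.cos t ^ 2 + w ^ 2 * Real.sin t ^ 2)) t := by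
  have hd := Real.cos_sq_add_mul_sin_sq_pos hw t
  have hd2 := Real.cos_sq_add_mul_sin_sq_pos (pow_pos hw 2) t
  have h1 : HasDerivAt (fun t => (w - 1) * (Real.sin t * Real.cos t))
      ((w - 1) * (Real.cos t * Real.cos t + Real.sin t * -Real.sin t)) t :=
    ((Real.hasDerivAt_sin t).mul (Real.hasDerivAt_cos t)).const_mul _
  have h2 : HasDerivAt (fun t => Real.cos t ^ 2 + w * Real.sin t ^ 2)
      ((2 : ℕ) * Real.cos t ^ (2 - 1) * -Real.sin t +
        w * ((2 : ℕ) * Real.sin t ^ (2 - 1) * Real.cos t)) t :=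
    ((Real.hasDerivAt_cos t).pow 2).add (((Real.hasDerivAt_sin t).pow 2).const_mul _)
  refine ((hasDerivAt_id t).add ((h1.div h2 hd.ne').arctan)).congr_deriv ?_
  have hsc := Real.sin_sq_add_cos_sq t
  simp only [Pi.div_apply]
  generalize Real.sin t = S at *
  generalize Real.cos t = c at *
  have e1 : 1 + ((w - 1) * (S * c) / (c ^ 2 + w * S ^ 2)) ^ 2 =
      (c ^ 2 + w ^ 2 * S ^ 2) / (c ^ 2 + w * S ^ 2) ^ 2 := by
    rw [div_pow, eq_div_iff (by positivity), add_mul, div_mul_cancel₀ _ (by positivity)]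
    linear_combination (c ^ 2 + w ^ 2 * S ^ 2) * hsc
  have e2 : (w - 1) * (c * c + S * -S) * (c ^ 2 + w * S ^ 2) - (w - 1) * (S * c) *
      ((2 : ℕ) * c ^ (2 - 1) * -S + w * ((2 : ℕ) * S ^ (2 - 1) * c)) =
      (w - 1) * (c ^ 2 - w * S ^ 2) := by
    norm_num
    linear_combination (w - 1) * (c ^ 2 - w * S ^ 2) * hsc
  rw [e1, e2]
  field_simp
  linear_combination w * hsc

theorem abs_scaledAngle_sub_le (w t : ℝ) : |scaledAngle w t - t| ≤ Real.pi / 2 := by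
  rw [scaledAngle, add_sub_cancel_left]
  exact abs_le.2 ⟨(Real.neg_pi_div_two_lt_arctan _).le, (Real.arctan_lt_pi_div_two _).le⟩

namespace IsPruferAngle

variable {l r ρ : ℝ} {s m κ : ℝ → ℝ} {lam : ℝ} {θ : ℝ → ℝ}

/-- Apart from the factor `√lam`, the speed is an average of `s` and `(1 - κ/lam) m` with weights
`cos² θ` and `lam sin² θ`. Bounds on these two functions thus bound the speed. -/
theorem hasDerivWithinAt_scaledAngle (hlam : 0 < lam) (h : IsPruferAngle l r ρ s m κ lam θ) :
    ∀ x ∈ Icc l r, HasDerivWithinAt (fun x => scaledAngle (√lam) (θ x))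
      (√lam * ((s x * Real.cos (θ x) ^ 2 + (lam - κ x) * m x * Real.sin (θ x) ^ 2) /
        (Real.cos (θ x) ^ 2 + lam * Real.sin (θ x) ^ 2))) (Icc l r) x := by
  intro x hx
  refine ((hasDerivAt_scaledAngle (Real.sqrt_pos.2 hlam) (θ x)).comp_hasDerivWithinAt x
    (h.deriv x hx)).congr_deriv ?_
  rw [Real.sq_sqrt hlam.le]
  ring

theorem init_mem (h : IsPruferAngle l r ρ s m κ lam θ) : 0 < θ l ∧ θ l < Real.pi := by
  rw [h.init]
  constructor <;> linarith [Real.neg_pi_div_two_lt_arctan ((lam - κ l) / ρ),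
    Real.arctan_lt_pi_div_two ((lam - κ l) / ρ)]

/-- The `2π` collects `θ l < π` and an error of at most `π/2` from the rescaling at each end. -/
theorem right_le {M : ℝ} (hlr : l ≤ r) (hlam : 0 < lam) (h : IsPruferAngle l r ρ s m κ lam θ)
    (hs : ∀ x ∈ Icc l r, s x ≤ M) (hm : ∀ x ∈ Icc l r, m x ≤ M)
    (hm0 : ∀ x ∈ Icc l r, 0 < m x) (hκ : ∀ x ∈ Icc l r, 0 ≤ κ x) :
    θ r ≤ 2 * Real.pi + √lam * M * (r - l) := by
  have hmono : MonotoneOn (fun x => √lam * M * x - scaledAngle (√lam) (θ x)) (Icc l r) := by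
    refine monotoneOn_Icc_of_hasDerivWithinAt (fun x hx => ((hasDerivWithinAt_id x _).const_mul
      (√lam * M)).sub (h.hasDerivWithinAt_scaledAngle hlam x hx)) fun x hx => ?_
    rw [mul_one, sub_nonneg]
    refine mul_le_mul_of_nonneg_left ?_ (Real.sqrt_nonneg _)
    rw [div_le_iff₀ (Real.cos_sq_add_mul_sin_sq_pos hlam _)]
    have h1 := mul_le_mul_of_nonneg_right (hs x hx) (sq_nonneg (Real.cos (θ x)))
    have h2 : (lam - κ x) * m x ≤ lam * M := by nlinarith [hs x hx, hm x hx, hm0 x hx, hκ x hx]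
    have h3 := mul_le_mul_of_nonneg_right h2 (sq_nonneg (Real.sin (θ x)))
    linarith
  have h1 := hmono (left_mem_Icc.2 hlr) (right_mem_Icc.2 hlr) hlr
  simp only at h1
  have h2 := abs_le.1 (abs_scaledAngle_sub_le (√lam) (θ l))
  have h3 := abs_le.1 (abs_scaledAngle_sub_le (√lam) (θ r))
  linarith [h.init_mem.2]

/-- `lam ≥ 2K` gives `lam - κ ≥ lam/2`, whence the factor `a / 2`; the `π` is the rescaling error at
the two ends. -/
theorem le_right {a K : ℝ} (hlr : l ≤ r) (hlam : 0 < lam) (h : IsPruferAngle l r ρ s m κ lam θ)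
    (ha : 0 < a) (hs : ∀ x ∈ Icc l r, a ≤ s x) (hm : ∀ x ∈ Icc l r, a ≤ m x)
    (hκ : ∀ x ∈ Icc l r, κ x ≤ K) (hK : 2 * K ≤ lam) :
    √lam * (a / 2) * (r - l) ≤ θ r + Real.pi := by
  have hmono : MonotoneOn (fun x => scaledAngle (√lam) (θ x) - √lam * (a / 2) * x) (Icc l r) := by
    refine monotoneOn_Icc_of_hasDerivWithinAt (fun x hx => (h.hasDerivWithinAt_scaledAngle hlam
      x hx).sub ((hasDerivWithinAt_id x _).const_mul (√lam * (a / 2)))) fun x hx => ?_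
    rw [mul_one, sub_nonneg]
    refine mul_le_mul_of_nonneg_left ?_ (Real.sqrt_nonneg _)
    rw [le_div_iff₀ (Real.cos_sq_add_mul_sin_sq_pos hlam _)]
    have h1 := mul_le_mul_of_nonneg_right (hs x hx) (sq_nonneg (Real.cos (θ x)))
    have h2 : a / 2 * lam ≤ (lam - κ x) * m x := by
      have h3 : lam / 2 ≤ lam - κ x := by linarith [hκ x hx]
      calc a / 2 * lam = lam / 2 * a := by ring
        _ ≤ (lam - κ x) * m x := mul_le_mul h3 (hm x hx) ha.le (by linarith)
    have h3 := mul_le_mul_of_nonneg_right h2 (sq_nonneg (Real.sin (θ x)))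
    nlinarith [mul_nonneg ha.le (sq_nonneg (Real.cos (θ x)))]
  have h1 := hmono (left_mem_Icc.2 hlr) (right_mem_Icc.2 hlr) hlr
  simp only at h1
  have h2 := abs_le.1 (abs_scaledAngle_sub_le (√lam) (θ l))
  have h3 := abs_le.1 (abs_scaledAngle_sub_le (√lam) (θ r))
  linarith [h.init_mem.1]

/-! ### The sequence of eigenvalues and its quadratic growth -/

/-- The parameters at which the Prüfer angle at `r` is a multiple of `π`, in increasing order. -/
theorem exists_spectrum (hlr : l < r) (hρ : 0 < ρ)
    (hs : ContinuousOn s (Icc l r)) (hm : ContinuousOn m (Icc l r))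
    (hκ : ContinuousOn κ (Icc l r)) (hspos : ∀ x ∈ Icc l r, 0 < s x)
    (hmpos : ∀ x ∈ Icc l r, 0 < m x) (hκ0 : ∀ x ∈ Icc l r, 0 ≤ κ x)
    {Θ : ℝ → ℝ → ℝ} (hΘ : ∀ lam, IsPruferAngle l r ρ s m κ lam (Θ lam)) :
    ∃ Λ : ℕ → ℝ, StrictMono Λ ∧ range Λ = {lam | Real.sin (Θ lam r) = 0} ∧ (∀ n, 0 < Λ n) ∧
      ∃ C₁ C₂ : ℝ, 0 < C₁ ∧ 0 < C₂ ∧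
        ∀ n : ℕ, C₁ * ((n : ℝ) + 1) ^ 2 ≤ Λ n ∧ Λ n ≤ C₂ * ((n : ℝ) + 1) ^ 2 := by
  have hr : r ∈ Icc l r := right_mem_Icc.2 hlr.le
  have hpi := Real.pi_pos
  have hL : 0 < r - l := sub_pos.2 hlr
  obtain ⟨M₁, hM₁, hM₁'⟩ := hs.exists_pos_abs_bound
  obtain ⟨M₂, hM₂, hM₂'⟩ := hm.exists_pos_abs_bound
  obtain ⟨K, hK, hK'⟩ := hκ.exists_pos_abs_bound
  obtain ⟨a₁, ha₁, ha₁'⟩ := hs.exists_pos_lower_bound hlr.le hspos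
  obtain ⟨a₂, ha₂, ha₂'⟩ := hm.exists_pos_lower_bound hlr.le hmpos
  have hup : ∀ lam, 0 < lam → Θ lam r ≤ 2 * Real.pi + √lam * max M₁ M₂ * (r - l) := fun lam h =>
    (hΘ lam).right_le hlr.le h
      (fun x hx => ((le_abs_self _).trans (hM₁' x hx)).trans (le_max_left _ _))
      (fun x hx => ((le_abs_self _).trans (hM₂' x hx)).trans (le_max_right _ _)) hmpos hκ0
  have hlow : ∀ lam, 2 * K ≤ lam → √lam * (min a₁ a₂ / 2) * (r - l) ≤ Θ lam r + Real.pi :=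
    fun lam h => (hΘ lam).le_right hlr.le (by linarith) (lt_min ha₁ ha₂)
      (fun x hx => (min_le_left _ _).trans (ha₁' x hx))
      (fun x hx => (min_le_right _ _).trans (ha₂' x hx))
      (fun x hx => (le_abs_self _).trans (hK' x hx)) h
  have hmpos' : 0 < max M₁ M₂ := lt_max_of_lt_left hM₁
  have hapos : 0 < min a₁ a₂ := lt_min ha₁ ha₂
  generalize max M₁ M₂ = M at *
  generalize min a₁ a₂ = a at *
  have hmono : StrictMono fun lam => Θ lam r := fun lam lam' h =>
    (hΘ lam).lt_of_lt hlr.le hρ hs hm hκ hmpos (hΘ lam') h r hr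
  have hcont : Continuous fun lam => Θ lam r := continuous_right hlr.le hρ hs hm hκ hΘ
  have h0 : Θ 0 r ≤ Real.pi / 2 := (hΘ 0).le_pi_div_two hlr.le hρ hs hmpos hκ0 r hr
  have hex : ∀ n : ℕ, ∃ lam, 0 < lam ∧ Θ lam r = ((n : ℝ) + 1) * Real.pi := fun n => by
    have hn : (0 : ℝ) ≤ n := n.cast_nonneg
    obtain ⟨B, hB0, hB⟩ : ∃ B : ℝ, 0 ≤ B ∧ ((n : ℝ) + 1) * Real.pi ≤ Θ B r := by
      -- Chosen so that, once `√lam ≥ q` and `lam ≥ 2K`, the lower bound reads `(n + 2) π ≤ Θ lam r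
      -- + π`.
      set q : ℝ := ((n : ℝ) + 2) * Real.pi / (a / 2 * (r - l)) with hq
      have hq0 : 0 ≤ q := by positivity
      refine ⟨max (2 * K) (q ^ 2), by positivity, ?_⟩
      have h1 := hlow _ (le_max_left (2 * K) (q ^ 2))
      have h2 : q ≤ √(max (2 * K) (q ^ 2)) := Real.le_sqrt_of_sq_le (le_max_right _ _)
      have h3 : q * (a / 2 * (r - l)) = ((n : ℝ) + 2) * Real.pi :=
        div_mul_cancel₀ _ (by positivity)
      have h4 := mul_le_mul_of_nonneg_right h2 (by positivity : 0 ≤ a / 2 * (r - l))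
      linarith
    obtain ⟨lam, hlam, he⟩ := intermediate_value_Icc hB0 hcont.continuousOn
      ⟨by nlinarith, hB⟩
    refine ⟨lam, hlam.1.lt_of_ne ?_, he⟩
    rintro rfl
    simp only at he
    nlinarith
  choose Λ hΛ0 hΛ using hex
  have hΛmono : StrictMono Λ := fun i j hij => by
    rw [← hmono.lt_iff_lt]
    simp only [hΛ]
    have : (i : ℝ) < j := by exact_mod_cast hij
    gcongr
  refine ⟨Λ, hΛmono, ?_, hΛ0, min (Λ 0 / 4) (Real.pi ^ 2 / (9 * (M * (r - l)) ^ 2)),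
    2 * K + 16 * Real.pi ^ 2 / (a * (r - l)) ^ 2, ?_, by positivity, fun n => ⟨?_, ?_⟩⟩
  · ext lam
    simp only [mem_range, mem_ofPred_eq, Real.sin_eq_zero_iff]
    constructor
    · rintro ⟨n, rfl⟩
      exact ⟨n + 1, by rw [hΛ]; push_cast; ring⟩
    · rintro ⟨j, hj⟩
      have hpos := (hΘ lam).pos hlr.le hm hκ hspos r hr
      have hj0 : 0 < j := by
        rw [← hj] at hpos
        exact_mod_cast (pos_of_mul_pos_left hpos hpi.le : (0 : ℝ) < j)
      obtain ⟨n, rfl⟩ : ∃ n : ℕ, j = n + 1 := ⟨(j - 1).toNat, by omega⟩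
      refine ⟨n, hmono.injective ?_⟩
      simp only [hΛ, ← hj]
      push_cast
      ring
  · have := hΛ0 0
    positivity
  · have hn2 : (0 : ℝ) ≤ ((n : ℝ) + 1) ^ 2 := by positivity
    -- The upper bound on the angle carries an additive `2π`. For `n ≥ 2` it is absorbed by `n - 1 ≥
    -- (n + 1)/3`; the two remaining indices are covered by `Λ 0 / 4`.
    rcases lt_or_ge n 2 with hn | hn
    · have h1 : Λ 0 ≤ Λ n := hΛmono.monotone n.zero_le
      have h2 : ((n : ℝ) + 1) ^ 2 ≤ 4 := by
        have : (n : ℝ) ≤ 1 := by exact_mod_cast Nat.lt_succ_iff.1 hn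
        have : (0 : ℝ) ≤ n := n.cast_nonneg
        nlinarith
      calc _ ≤ Λ 0 / 4 * ((n : ℝ) + 1) ^ 2 := mul_le_mul_of_nonneg_right (min_le_left _ _) hn2
        _ ≤ Λ 0 / 4 * 4 := mul_le_mul_of_nonneg_left h2 (by linarith [hΛ0 0])
        _ ≤ Λ n := by linarith
    · have h1 := hup _ (hΛ0 n)
      rw [hΛ] at h1
      have hn' : (2 : ℝ) ≤ n := by exact_mod_cast hn
      have h2 : ((n : ℝ) + 1) * Real.pi ≤ 3 * √(Λ n) * (M * (r - l)) := by nlinarith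
      have h3 := pow_le_pow_left₀ (by positivity) h2 2
      rw [mul_pow _ (M * (r - l)), mul_pow, mul_pow, Real.sq_sqrt (hΛ0 n).le] at h3
      calc _ ≤ Real.pi ^ 2 / (9 * (M * (r - l)) ^ 2) * ((n : ℝ) + 1) ^ 2 :=
            mul_le_mul_of_nonneg_right (min_le_right _ _) hn2
        _ ≤ Λ n := by
          rw [div_mul_eq_mul_div, div_le_iff₀ (by positivity)]
          linarith
  · have hn : (0 : ℝ) ≤ n := n.cast_nonneg
    have hn2 : (1 : ℝ) ≤ ((n : ℝ) + 1) ^ 2 := by nlinarith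
    rw [add_mul]
    -- Below `2K` the first summand of the constant suffices; above it, `n + 2 ≤ 2 (n + 1)` yields
    -- the second.
    rcases lt_or_ge (Λ n) (2 * K) with h | h
    · have h1 : 0 ≤ 16 * Real.pi ^ 2 / (a * (r - l)) ^ 2 * ((n : ℝ) + 1) ^ 2 := by positivity
      nlinarith
    · have h1 := hlow _ h
      rw [hΛ] at h1
      have h2 : √(Λ n) * (a * (r - l)) ≤ 4 * Real.pi * ((n : ℝ) + 1) := by nlinarith
      have h3 := pow_le_pow_left₀ (by positivity) h2 2
      rw [mul_pow, Real.sq_sqrt (hΛ0 n).le] at h3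
      have h4 : Λ n ≤ 16 * Real.pi ^ 2 / (a * (r - l)) ^ 2 * ((n : ℝ) + 1) ^ 2 := by
        rw [div_mul_eq_mul_div, le_div_iff₀ (by positivity)]
        linarith
      have h5 : 0 ≤ 2 * K * ((n : ℝ) + 1) ^ 2 := by positivity
      linarith

end IsPruferAngle

/-! ### Scale and speed densities; the equation as a first-order system -/

theorem scaleDensity_pos (l : ℝ) (μ σ : ℝ → ℝ) (x : ℝ) : 0 < scaleDensity l μ σ x :=
  Real.exp_pos _

theorem scaleDensity_left (l : ℝ) (μ σ : ℝ → ℝ) : scaleDensity l μ σ l = 1 := by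
  simp [scaleDensity]

theorem hasDerivWithinAt_scaleDensity {l r : ℝ} {μ σ : ℝ → ℝ} (hlr : l ≤ r)
    (hμ : ContinuousOn μ (Icc l r)) (hσ : ContinuousOn (fun x => σ x ^ 2) (Icc l r))
    (hσpos : ∀ x ∈ Icc l r, 0 < σ x ^ 2) : ∀ x ∈ Icc l r,
      HasDerivWithinAt (scaleDensity l μ σ) (-(2 * μ x / σ x ^ 2) * scaleDensity l μ σ x)
        (Icc l r) x := by
  have hc : ContinuousOn (fun x => 2 * μ x / σ x ^ 2) (Icc l r) :=
    (continuousOn_const.mul hμ).div hσ fun x hx => (hσpos x hx).ne'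
  obtain ⟨G, hG, hG'⟩ := exists_antideriv_Icc hlr hc
  have he : ∀ x ∈ Icc l r, scaleDensity l μ σ x = Real.exp (-G x) := fun x hx => by
    rw [scaleDensity, hG x hx]
  intro x hx
  refine ((hG' x hx).fun_neg.exp.congr he (he x hx)).congr_deriv ?_
  rw [he x hx, mul_comm]

theorem speedDensity_pos {l x : ℝ} {μ σ : ℝ → ℝ} (hσ : 0 < σ x ^ 2) :
    0 < speedDensity l μ σ x :=
  div_pos two_pos (mul_pos hσ (scaleDensity_pos l μ σ x))

theorem continuousOn_speedDensity {l r : ℝ} {μ σ : ℝ → ℝ}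
    (hs : ContinuousOn (scaleDensity l μ σ) (Icc l r))
    (hσ : ContinuousOn (fun x => σ x ^ 2) (Icc l r))
    (hσpos : ∀ x ∈ Icc l r, 0 < σ x ^ 2) : ContinuousOn (speedDensity l μ σ) (Icc l r) :=
  continuousOn_const.div (hσ.mul hs) fun x hx =>
    (mul_pos (hσpos x hx) (scaleDensity_pos l μ σ x)).ne'

namespace SolvesStickySL

variable {l r ρ : ℝ} {μ σ κ : ℝ → ℝ} {lam : ℝ} {φ : ℝ → ℝ}

theorem hasDerivWithinAt (hlr : l < r) (h : SolvesStickySL l r ρ μ σ κ lam φ) :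
    ∀ x ∈ Icc l r, HasDerivWithinAt φ (derivWithin φ (Icc l r) x) (Icc l r) x := by
  intro x hx
  have := h.contDiffOn.hasDerivWithinAt_iteratedDerivWithin (n := 2) (uniqueDiffOn_Icc hlr)
    (i := 0) two_pos hx
  simpa [iteratedDerivWithin_one] using this

/-- The equation is given on the open interval only; both sides are continuous on `[l, r]`, so it
extends to the end points. -/
theorem hasDerivWithinAt_derivWithin (hlr : l < r)
    (hμ : ContinuousOn μ (Icc l r)) (hσ : ContinuousOn (fun x => σ x ^ 2) (Icc l r))
    (hσpos : ∀ x ∈ Icc l r, 0 < σ x ^ 2) (hκ : ContinuousOn κ (Icc l r))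
    (h : SolvesStickySL l r ρ μ σ κ lam φ) :
    ∀ x ∈ Icc l r, HasDerivWithinAt (derivWithin φ (Icc l r))
      (2 * ((κ x - lam) * φ x - μ x * derivWithin φ (Icc l r) x) / σ x ^ 2) (Icc l r) x := by
  have hu := uniqueDiffOn_Icc hlr
  have hd : ∀ x ∈ Icc l r, HasDerivWithinAt (derivWithin φ (Icc l r))
      (iteratedDerivWithin 2 φ (Icc l r) x) (Icc l r) x := fun x hx => by
    have := h.contDiffOn.hasDerivWithinAt_iteratedDerivWithin (n := 2) hu (i := 1) one_lt_two hx
    exact this.congr (fun y _ => by rw [iteratedDerivWithin_one])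
      (by rw [iteratedDerivWithin_one])
  have h2c : ContinuousOn (iteratedDerivWithin 2 φ (Icc l r)) (Icc l r) :=
    h.contDiffOn.continuousOn_iteratedDerivWithin (m := 2) le_rfl hu
  have h1c : ContinuousOn (derivWithin φ (Icc l r)) (Icc l r) := fun x hx =>
    (hd x hx).continuousWithinAt
  have hrhs : ContinuousOn
      (fun x => 2 * ((κ x - lam) * φ x - μ x * derivWithin φ (Icc l r) x) / σ x ^ 2) (Icc l r) :=
    (continuousOn_const.mul (((hκ.sub continuousOn_const).mul h.contDiffOn.continuousOn).sub
      (hμ.mul h1c))).div hσ fun x hx => (hσpos x hx).ne'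
  have he : EqOn (iteratedDerivWithin 2 φ (Icc l r))
      (fun x => 2 * ((κ x - lam) * φ x - μ x * derivWithin φ (Icc l r) x) / σ x ^ 2)
      (Icc l r) := by
    refine EqOn.of_subset_closure (fun x hx => ?_) h2c hrhs Ioo_subset_Icc_self
      (closure_Ioo hlr.ne).ge
    have := h.eigen_eq x hx
    simp only [stickyGenerator, if_pos hx.1, if_neg hx.1.ne', add_zero] at this
    rw [eq_div_iff (hσpos x (Ioo_subset_Icc_self hx)).ne']
    linarith
  exact fun x hx => (hd x hx).congr_deriv (he hx)

theorem of_hasDerivWithinAt {φ₁ : ℝ → ℝ} (hlr : l < r)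
    (hμ : ContinuousOn μ (Icc l r)) (hσ : ContinuousOn (fun x => σ x ^ 2) (Icc l r))
    (hσpos : ∀ x ∈ Icc l r, 0 < σ x ^ 2) (hκ : ContinuousOn κ (Icc l r))
    (h₁ : ∀ x ∈ Icc l r, HasDerivWithinAt φ (φ₁ x) (Icc l r) x)
    (h₂ : ∀ x ∈ Icc l r, HasDerivWithinAt φ₁
      (2 * ((κ x - lam) * φ x - μ x * φ₁ x) / σ x ^ 2) (Icc l r) x)
    (hl : ρ * φ₁ l - (κ l - lam) * φ l = 0) (hr : φ r = 0) :
    SolvesStickySL l r ρ μ σ κ lam φ := by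
  have hu := uniqueDiffOn_Icc hlr
  let F : ℕ → ℝ → ℝ
    | 0 => φ
    | 1 => φ₁
    | _ => fun x => 2 * ((κ x - lam) * φ x - μ x * φ₁ x) / σ x ^ 2
  have hF : ∀ i < 2, ∀ x ∈ Icc l r, HasDerivWithinAt (F i) (F (i + 1) x) (Icc l r) x := by
    intro i hi
    interval_cases i
    exacts [h₁, h₂]
  have hFc : ContinuousOn (F 2) (Icc l r) :=
    (continuousOn_const.mul (((hκ.sub continuousOn_const).mul
      fun x hx => (h₁ x hx).continuousWithinAt).sub
      (hμ.mul fun x hx => (h₂ x hx).continuousWithinAt))).div hσ fun x hx => (hσpos x hx).ne'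
  have hd1 : ∀ x ∈ Icc l r, derivWithin φ (Icc l r) x = φ₁ x := fun x hx =>
    (h₁ x hx).derivWithin (hu x hx)
  refine ⟨contDiffOn_of_hasDerivWithinAt_chain hu 2 hF hFc, fun x hx => ?_, ?_, hr⟩
  · have hx' := Ioo_subset_Icc_self hx
    have e2 : iteratedDerivWithin 2 φ (Icc l r) x =
        2 * ((κ x - lam) * φ x - μ x * φ₁ x) / σ x ^ 2 :=
      iteratedDerivWithin_eqOn_of_hasDerivWithinAt hu 2 hF 2 le_rfl hx'
    simp only [stickyGenerator, if_pos hx.1, if_neg hx.1.ne', add_zero, hd1 x hx', e2]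
    have hσ0 : σ x ≠ 0 := (pow_ne_zero_iff two_ne_zero).1 (hσpos x hx').ne'
    field_simp
    ring
  · rwa [hd1 l (left_mem_Icc.2 hlr.le)]

/-- The scale density is the integrating factor that removes the drift. -/
theorem hasDerivWithinAt_flux (hlr : l < r)
    (hμ : ContinuousOn μ (Icc l r)) (hσ : ContinuousOn (fun x => σ x ^ 2) (Icc l r))
    (hσpos : ∀ x ∈ Icc l r, 0 < σ x ^ 2) (hκ : ContinuousOn κ (Icc l r))
    (h : SolvesStickySL l r ρ μ σ κ lam φ) :
    ∀ x ∈ Icc l r, HasDerivWithinAt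
      (fun x => derivWithin φ (Icc l r) x / scaleDensity l μ σ x)
      ((κ x - lam) * speedDensity l μ σ x * φ x) (Icc l r) x := by
  intro x hx
  have hs := scaleDensity_pos l μ σ x
  refine ((h.hasDerivWithinAt_derivWithin hlr hμ hσ hσpos hκ x hx).div
    (hasDerivWithinAt_scaleDensity hlr.le hμ hσ hσpos x hx) hs.ne').congr_deriv ?_
  have := (hσpos x hx).ne'
  have := hs.ne'
  rw [speedDensity]
  field_simp
  ring

end SolvesStickySL

/-! ### Prüfer substitution: solutions are multiples of one function -/

/-- A solution of the problem with parameter `lam` is a multiple of `R sin θ`, with `θ` the Prüfer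
angle and `R` the Prüfer radius; and `R sin θ` is a solution if it vanishes at `r`. -/
theorem IsPruferAngle.exists_radius {l r ρ : ℝ} {μ σ κ : ℝ → ℝ} {lam : ℝ} {θ : ℝ → ℝ}
    (hlr : l < r) (hρ : 0 < ρ)
    (hμ : ContinuousOn μ (Icc l r)) (hσ : ContinuousOn (fun x => σ x ^ 2) (Icc l r))
    (hσpos : ∀ x ∈ Icc l r, 0 < σ x ^ 2) (hκ : ContinuousOn κ (Icc l r))
    (hθ : IsPruferAngle l r ρ (scaleDensity l μ σ) (speedDensity l μ σ) κ lam θ) :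
    ∃ R : ℝ → ℝ, (∀ x, 0 < R x) ∧
      (∀ φ, SolvesStickySL l r ρ μ σ κ lam φ →
        ∃ c : ℝ, ∀ x ∈ Icc l r, φ x = c * (R x * Real.sin (θ x))) ∧
      (Real.sin (θ r) = 0 → SolvesStickySL l r ρ μ σ κ lam fun x => R x * Real.sin (θ x)) := by
  have hl : l ∈ Icc l r := left_mem_Icc.2 hlr.le
  have hsd := hasDerivWithinAt_scaleDensity hlr.le hμ hσ hσpos
  have hs0 := scaleDensity_pos l μ σ
  have hs1 := scaleDensity_left l μ σ
  have hs : ContinuousOn (scaleDensity l μ σ) (Icc l r) := fun x hx =>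
    (hsd x hx).continuousWithinAt
  have hm := continuousOn_speedDensity hs hσ hσpos
  have hsm : ∀ x, speedDensity l μ σ x = 2 / (σ x ^ 2 * scaleDensity l μ σ x) := fun _ => rfl
  have hflux := fun φ (h : SolvesStickySL l r ρ μ σ κ lam φ) =>
    h.hasDerivWithinAt_flux hlr hμ hσ hσpos hκ
  generalize scaleDensity l μ σ = s at *
  generalize speedDensity l μ σ = m at *
  have hθd := hθ.deriv
  have hθc := hθ.continuousOn
  have hg : ContinuousOn (fun x => (s x - (lam - κ x) * m x) *
      (Real.sin (θ x) * Real.cos (θ x))) (Icc l r) :=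
    (hs.sub ((continuousOn_const.sub hκ).mul hm)).mul
      ((Real.continuous_sin.comp_continuousOn hθc).mul (Real.continuous_cos.comp_continuousOn hθc))
  obtain ⟨R, hR1, hR, hR'⟩ := exists_pos_linear_solution hlr.le hg
  have hbc : ρ * Real.cos (θ l) = (κ l - lam) * Real.sin (θ l) := by
    rw [hθ.init, add_comm, Real.cos_add_pi_div_two, Real.sin_add_pi_div_two]
    have h1 := Real.tan_mul_cos (Real.cos_arctan_pos ((lam - κ l) / ρ)).ne'
    rw [Real.tan_arctan] at h1
    rw [← h1]
    field_simp
    ring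
  refine ⟨R, hR, fun φ h => ?_, fun hr => ?_⟩
  · have hu := h.hasDerivWithinAt hlr
    have hv := hflux φ h
    have hlbc := h.left_bc
    set v := fun x => derivWithin φ (Icc l r) x / s x with hvdef
    have hu' : ∀ x ∈ Icc l r, HasDerivWithinAt φ (s x * v x) (Icc l r) x := fun x hx =>
      (hu x hx).congr_deriv (by rw [hvdef]; field_simp [(hs0 x).ne'])
    have hcosd := fun x hx => (hθd x hx).cos
    have hsind := fun x hx => (hθd x hx).sin
    -- This component of `(φ, v)` orthogonal to `(sin θ, cos θ)` solves a homogeneous linear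
    -- equation and vanishes at `l` by the boundary condition.
    have hW : ∀ x ∈ Icc l r, φ x * Real.cos (θ x) - v x * Real.sin (θ x) = 0 := by
      intro x hx
      obtain ⟨w, hw1, hw, hw'⟩ := exists_pos_linear_solution hlr.le hg.fun_neg
      have := linear_solution_unique hw hw1 hw'
        (y := fun x => φ x * Real.cos (θ x) - v x * Real.sin (θ x)) (fun x hx => ?_) x hx
      · rw [this]
        have : v l = derivWithin φ (Icc l r) l := by rw [hvdef]; simp [hs1]
        have : ρ * (φ l * Real.cos (θ l) - v l * Real.sin (θ l)) = 0 := by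
          rw [this]
          linear_combination φ l * hbc - Real.sin (θ l) * hlbc
        rw [(mul_eq_zero.1 this).resolve_left hρ.ne', zero_mul]
      · refine (((hu' x hx).mul (hcosd x hx)).sub ((hv x hx).mul (hsind x hx))).congr_deriv ?_
        linear_combination -(v x * Real.cos (θ x) * s x +
          φ x * Real.sin (θ x) * ((lam - κ x) * m x)) * Real.sin_sq_add_cos_sq (θ x)
    refine ⟨φ l * Real.sin (θ l) + v l * Real.cos (θ l), fun x hx => ?_⟩
    -- The remaining component solves the equation of `R`, but only modulo the vanishing of the
    -- orthogonal one.
    have hZ := linear_solution_unique hR hR1 hR'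
      (y := fun x => φ x * Real.sin (θ x) + v x * Real.cos (θ x)) (fun x hx => ?_) x hx
    · rw [← mul_assoc, ← hZ]
      linear_combination Real.cos (θ x) * hW x hx - φ x * Real.sin_sq_add_cos_sq (θ x)
    · refine (((hu' x hx).mul (hsind x hx)).add ((hv x hx).mul (hcosd x hx))).congr_deriv ?_
      linear_combination (s x * Real.cos (θ x) ^ 2 + (lam - κ x) * m x * Real.sin (θ x) ^ 2 -
        (lam - κ x) * m x - (s x - (lam - κ x) * m x) * Real.sin (θ x) ^ 2) * hW x hx -
        (s x - (lam - κ x) * m x) * (v x * Real.sin (θ x)) * Real.sin_sq_add_cos_sq (θ x)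
  · refine SolvesStickySL.of_hasDerivWithinAt (φ₁ := fun x => s x * (R x * Real.cos (θ x))) hlr
      hμ hσ hσpos hκ (fun x hx => ?_) (fun x hx => ?_) ?_ (by simp [hr])
    · refine ((hR' x hx).mul (hθd x hx).sin).congr_deriv ?_
      linear_combination s x * R x * Real.cos (θ x) * Real.sin_sq_add_cos_sq (θ x)
    · refine ((hsd x hx).mul ((hR' x hx).mul (hθd x hx).cos)).congr_deriv ?_
      have := Real.sin_sq_add_cos_sq (θ x)
      have h2 : s x * m x = 2 / σ x ^ 2 := by
        rw [hsm]
        field_simp [(hs0 x).ne', (hσpos x hx).ne']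
      have h3 : 2 * ((κ x - lam) * (R x * Real.sin (θ x)) - μ x * (s x * (R x * Real.cos (θ x)))) /
          σ x ^ 2 = (s x * m x) * ((κ x - lam) * (R x * Real.sin (θ x))) -
            2 * μ x / σ x ^ 2 * (s x * (R x * Real.cos (θ x))) := by
        rw [h2]
        ring
      simp only [Pi.mul_apply]
      rw [h3]
      linear_combination s x * m x * (κ x - lam) * R x * Real.sin (θ x) * this
    · simp only [hs1, hR1]
      linear_combination hbc

/-! ### Energy estimate for normalized eigenfunctions -/

/-- Normalized solutions satisfy `|φ| ≤ C` and `|φ'| ≤ C √lam`, uniformly in `lam ≥ lam₀`. -/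
theorem exists_energy_bound {l r ρ lam₀ : ℝ} {μ σ κ : ℝ → ℝ} (hlr : l < r) (hρ : 0 < ρ)
    (hlam₀ : 0 < lam₀) (hμ : ContinuousOn μ (Icc l r))
    (hσ : ContDiffOn ℝ 1 (fun x => σ x ^ 2) (Icc l r))
    (hσpos : ∀ x ∈ Icc l r, 0 < σ x ^ 2) (hκ : ContinuousOn κ (Icc l r))
    (hκ0 : ∀ x ∈ Icc l r, 0 ≤ κ x) :
    ∃ C > 0, ∀ lam φ, lam₀ ≤ lam → SolvesStickySL l r ρ μ σ κ lam φ →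
      speedInner l r ρ μ σ φ φ = 1 → ∀ x ∈ Icc l r,
        φ x ^ 2 ≤ C ∧ derivWithin φ (Icc l r) x ^ 2 ≤ C * lam := by
  have hl : l ∈ Icc l r := left_mem_Icc.2 hlr.le
  have hr : r ∈ Icc l r := right_mem_Icc.2 hlr.le
  have hL : 0 < r - l := sub_pos.2 hlr
  have hu := uniqueDiffOn_Icc hlr
  have hσc := hσ.continuousOn
  have hsd := hasDerivWithinAt_scaleDensity hlr.le hμ hσc hσpos
  have hsc : ContinuousOn (scaleDensity l μ σ) (Icc l r) := fun x hx =>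
    (hsd x hx).continuousWithinAt
  have hmc := continuousOn_speedDensity hsc hσc hσpos
  obtain ⟨m₀, hm₀, hm₀'⟩ := hmc.exists_pos_lower_bound hlr.le
    fun x hx => speedDensity_pos (hσpos x hx)
  obtain ⟨b, hb, hb'⟩ := hσc.exists_pos_lower_bound hlr.le hσpos
  obtain ⟨D, hDc, hD⟩ : ∃ D : ℝ → ℝ, ContinuousOn D (Icc l r) ∧
      ∀ x ∈ Icc l r, HasDerivWithinAt (fun x => σ x ^ 2) (D x) (Icc l r) x :=
    ⟨_, hσ.continuousOn_derivWithin hu le_rfl, fun x hx =>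
      (hσ.differentiableOn one_ne_zero x hx).hasDerivWithinAt⟩
  obtain ⟨A, hA, hA'⟩ := ((continuousOn_const.mul hDc).sub
    (continuousOn_const.mul hμ) : ContinuousOn (fun x => 1 / 2 * D x - 2 * μ x)
      (Icc l r)).exists_pos_abs_bound
  obtain ⟨K, hK, hK'⟩ := hκ.exists_pos_abs_bound
  set G := 2 * (A + K) / b + K / lam₀ with hG
  have hG0 : 0 ≤ G := by positivity
  set B := 2 * Real.exp (G * (r - l)) / (m₀ * (r - l)) with hB
  have hB0 : 0 < B := by positivity
  refine ⟨B + 2 * B / b, by positivity, fun lam φ hlam h hn => ?_⟩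
  have hlampos : 0 < lam := hlam₀.trans_le hlam
  have hφ := h.hasDerivWithinAt hlr
  have hφ' := h.hasDerivWithinAt_derivWithin hlr hμ hσc hσpos hκ
  have hv := h.hasDerivWithinAt_flux hlr hμ hσc hσpos hκ
  have hlbc := h.left_bc
  set p := derivWithin φ (Icc l r) with hp
  set E : ℝ → ℝ := fun x => lam * φ x ^ 2 + 1 / 2 * (σ x ^ 2 * p x ^ 2) with hE
  -- The terms `± 2 lam φ φ'` cancel: this is what makes the logarithmic derivative of the energy
  -- bounded independently of `lam`.
  have hEd : ∀ x ∈ Icc l r, HasDerivWithinAt E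
      ((1 / 2 * D x - 2 * μ x) * p x ^ 2 + 2 * κ x * (φ x * p x)) (Icc l r) x := fun x hx => by
    refine ((((hφ x hx).pow 2).const_mul lam).add
      (((hD x hx).mul ((hφ' x hx).pow 2)).const_mul (1 / 2))).congr_deriv ?_
    have hσ0 : σ x ≠ 0 := (pow_ne_zero_iff two_ne_zero).1 (hσpos x hx).ne'
    simp only [Pi.pow_apply]
    field_simp
    ring
  have hE0 : ∀ x ∈ Icc l r, lam * φ x ^ 2 ≤ E x ∧ b / 2 * p x ^ 2 ≤ E x := fun x hx => by
    have h1 := mul_le_mul_of_nonneg_right (hb' x hx) (sq_nonneg (p x))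
    have h2 := mul_nonneg hlampos.le (sq_nonneg (φ x))
    have h3 := mul_nonneg hb.le (sq_nonneg (p x))
    simp only [hE]
    constructor <;> linarith
  have hEpos : ∀ x ∈ Icc l r, 0 ≤ E x := fun x hx =>
    (mul_nonneg hlampos.le (sq_nonneg (φ x))).trans (hE0 x hx).1
  have hEb : ∀ x ∈ Icc l r,
      |(1 / 2 * D x - 2 * μ x) * p x ^ 2 + 2 * κ x * (φ x * p x)| ≤ G * E x := fun x hx => by
    have h1 : |(1 / 2 * D x - 2 * μ x) * p x ^ 2| ≤ A * p x ^ 2 := by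
      rw [abs_mul, abs_of_nonneg (sq_nonneg (p x))]
      exact mul_le_mul_of_nonneg_right (hA' x hx) (sq_nonneg _)
    have h2 : |2 * κ x * (φ x * p x)| ≤ K * (φ x ^ 2 + p x ^ 2) := by
      have h3 : |2 * (φ x * p x)| ≤ φ x ^ 2 + p x ^ 2 := by
        rw [abs_le]
        constructor <;> nlinarith [sq_nonneg (φ x + p x), sq_nonneg (φ x - p x)]
      calc |2 * κ x * (φ x * p x)| = |κ x| * |2 * (φ x * p x)| := by rw [← abs_mul]; ring_nf
        _ ≤ K * (φ x ^ 2 + p x ^ 2) := mul_le_mul (hK' x hx) h3 (abs_nonneg _) hK.le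
    have h3 : p x ^ 2 ≤ 2 / b * E x := by
      rw [div_mul_eq_mul_div, le_div_iff₀ hb]
      linarith [(hE0 x hx).2]
    have h4 : φ x ^ 2 ≤ 1 / lam₀ * E x := by
      rw [div_mul_eq_mul_div, le_div_iff₀ hlam₀]
      have := mul_le_mul_of_nonneg_right hlam (sq_nonneg (φ x))
      linarith [(hE0 x hx).1]
    calc _ ≤ (A + K) * p x ^ 2 + K * φ x ^ 2 := (abs_add_le _ _).trans (by linarith)
      _ ≤ (A + K) * (2 / b * E x) + K * (1 / lam₀ * E x) := by gcongr
      _ = G * E x := by rw [hG]; ring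
  have hEE := le_exp_mul_of_abs_deriv_le hEd hEb hEpos hG0
  have hφc := h.contDiffOn.continuousOn
  obtain ⟨I, hI, hI'⟩ := exists_antideriv_Icc hlr.le ((hφc.mul hφc).mul hmc)
  have hEle : ∀ x ∈ Icc l r, E x ≤ B * lam := fun x hx => by
    set c := m₀ * (E x / Real.exp (G * (r - l))) with hc
    -- The first two terms have derivative `m E + κ m φ²`, and `c` is a lower bound for `m E`
    -- because `E` varies by a factor of at most `exp (G (r - l))`.
    have hmono : MonotoneOn (fun y => 2 * lam * I y + φ y * (p y / scaleDensity l μ σ y) - c * y)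
        (Icc l r) := by
      refine monotoneOn_Icc_of_hasDerivWithinAt (fun y hy => ((((hI' y hy).const_mul
        (2 * lam)).add ((hφ y hy).mul (hv y hy))).sub
          ((hasDerivWithinAt_id y _).const_mul c))) fun y hy => ?_
      have h1 : c ≤ speedDensity l μ σ y * E y := by
        refine mul_le_mul (hm₀' y hy) ?_ (div_nonneg (hEpos x hx) (Real.exp_pos _).le)
          (speedDensity_pos (hσpos y hy)).le
        rw [div_le_iff₀ (Real.exp_pos _), mul_comm]
        exact hEE x hx y hy
      have h2 : speedDensity l μ σ y * E y = lam * (φ y * φ y * speedDensity l μ σ y) +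
          p y * (p y / scaleDensity l μ σ y) := by
        have hσ0 : σ y ≠ 0 := (pow_ne_zero_iff two_ne_zero).1 (hσpos y hy).ne'
        have := (scaleDensity_pos l μ σ y).ne'
        simp only [hE, speedDensity]
        field_simp
      have h3 : 0 ≤ κ y * (φ y * φ y * speedDensity l μ σ y) := mul_nonneg (hκ0 y hy)
        (mul_nonneg (mul_self_nonneg _) (speedDensity_pos (hσpos y hy)).le)
      simp only [Pi.mul_apply, mul_one]
      linarith
    have h1 := hmono hl hr hlr.le
    have hIl : I l = 0 := by rw [hI l hl, intervalIntegral.integral_same]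
    have hIr : I r = 1 - 1 / ρ * φ l * φ l := by
      rw [speedInner] at hn
      rw [hI r hr]
      exact eq_sub_of_add_eq' hn
    have hpl : p l = (κ l - lam) * φ l / ρ := by
      rw [eq_div_iff hρ.ne']
      linarith
    simp only [hIl, hIr, h.right_bc, scaleDensity_left, hpl] at h1
    -- The atom at `l` in the norm and the sticky condition together contribute minus this quantity
    -- to the bound, so they can be dropped.
    have h2 : 0 ≤ φ l * φ l / ρ * (lam + κ l) := mul_nonneg
      (div_nonneg (mul_self_nonneg _) hρ.le) (add_nonneg hlampos.le (hκ0 l hl))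
    have h3 : c * (r - l) ≤ 2 * lam := by
      ring_nf at h1 h2 ⊢
      linarith
    have h4 : E x = c * (r - l) * (Real.exp (G * (r - l)) / (m₀ * (r - l))) := by
      have := (Real.exp_pos (G * (r - l))).ne'
      rw [hc]
      field_simp
    rw [h4]
    calc _ ≤ 2 * lam * (Real.exp (G * (r - l)) / (m₀ * (r - l))) := by gcongr
      _ = B * lam := by rw [hB]; ring
  intro x hx
  have h1 := (hE0 x hx).1.trans (hEle x hx)
  have h2 := (hE0 x hx).2.trans (hEle x hx)
  have h5 : 0 ≤ 2 * B / b := by positivity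
  constructor
  · have h3 : φ x ^ 2 ≤ B := le_of_mul_le_mul_left (by linarith) hlampos
    linarith
  · have h3 : p x ^ 2 ≤ 2 * B / b * lam := by
      rw [div_mul_eq_mul_div, le_div_iff₀ hb]
      linarith
    nlinarith

/-! ### Higher derivatives by differentiating the equation -/

/-- Derivatives up to order four of a solution of `φ'' = a φ' + (p - lam q) φ` with
`0 ≤ lam ≤ C₂ N²`, in terms of bounds for `φ` and `φ'`. -/
theorem exists_derivative_bounds {l r C C₂ : ℝ} {a p q : ℝ → ℝ} (hlr : l < r) (hC : 0 ≤ C)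
    (hC₂ : 0 ≤ C₂) (ha : ContDiffOn ℝ 2 a (Icc l r)) (hp : ContDiffOn ℝ 2 p (Icc l r))
    (hq : ContDiffOn ℝ 2 q (Icc l r)) :
    ∃ C₃ > 0, ∀ (lam N : ℝ) (φ φ₁ : ℝ → ℝ), 1 ≤ N → 0 ≤ lam → lam ≤ C₂ * N ^ 2 →
      (∀ x ∈ Icc l r, HasDerivWithinAt φ (φ₁ x) (Icc l r) x) →
      (∀ x ∈ Icc l r, HasDerivWithinAt φ₁ (a x * φ₁ x + (p x - lam * q x) * φ x) (Icc l r) x) →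
      (∀ x ∈ Icc l r, |φ x| ≤ C) → (∀ x ∈ Icc l r, |φ₁ x| ≤ C * N) →
      ContDiffOn ℝ 4 φ (Icc l r) ∧ ∀ i ≤ 4, ∀ x ∈ Icc l r,
        |iteratedDerivWithin i φ (Icc l r) x| ≤ C₃ * N ^ i := by
  have hu := uniqueDiffOn_Icc hlr
  have hder : ∀ {f : ℝ → ℝ}, ContDiffOn ℝ 2 f (Icc l r) → ∃ f₁ f₂ : ℝ → ℝ,
      (∀ x ∈ Icc l r, HasDerivWithinAt f (f₁ x) (Icc l r) x) ∧
      (∀ x ∈ Icc l r, HasDerivWithinAt f₁ (f₂ x) (Icc l r) x) ∧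
      ContinuousOn f₂ (Icc l r) ∧
      ∃ M > 0, ∀ x ∈ Icc l r, |f x| ≤ M ∧ |f₁ x| ≤ M ∧ |f₂ x| ≤ M := by
    intro f hf
    have h1 := fun x hx => hf.hasDerivWithinAt_iteratedDerivWithin (n := 2) hu (i := 0) two_pos
      (x := x) hx
    have h2 := fun x hx => hf.hasDerivWithinAt_iteratedDerivWithin (n := 2) hu (i := 1) one_lt_two
      (x := x) hx
    have h3 := hf.continuousOn_iteratedDerivWithin (m := 2) le_rfl hu
    rw [iteratedDerivWithin_zero] at h1
    obtain ⟨M₀, _, hM₀⟩ := hf.continuousOn.exists_pos_abs_bound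
    obtain ⟨M₁, _, hM₁⟩ := ContinuousOn.exists_pos_abs_bound
      fun x hx => (h2 x hx).continuousWithinAt
    obtain ⟨M₂, _, hM₂⟩ := h3.exists_pos_abs_bound
    exact ⟨_, _, h1, h2, h3, M₀ + M₁ + M₂, by positivity, fun x hx =>
      ⟨(hM₀ x hx).trans (by linarith), (hM₁ x hx).trans (by linarith),
        (hM₂ x hx).trans (by linarith)⟩⟩
  obtain ⟨a₁, a₂, ha₁, ha₂, hac, Ma, hMa, hMa'⟩ := hder ha
  obtain ⟨p₁, p₂, hp₁, hp₂, hpc, Mp, hMp, hMp'⟩ := hder hp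
  obtain ⟨q₁, q₂, hq₁, hq₂, hqc, Mq, hMq, hMq'⟩ := hder hq
  set Q := Mp + C₂ * Mq with hQ
  have hQ0 : 0 ≤ Q := by positivity
  set K₂ := Ma * C + Q * C with hK₂
  set K₃ := Ma * C + Ma * K₂ + (Q * C + Q * C) with hK₃
  set K₄ := Ma * C + 2 * (Ma * K₂) + Ma * K₃ + (Q * C + 2 * (Q * C) + Q * K₂) with hK₄
  refine ⟨1 + C + K₂ + K₃ + K₄, by positivity, fun lam N φ φ₁ hN hlam hlamN h₁ h₂ hb₀ hb₁ => ?_⟩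
  have hN0 : 0 ≤ N := by linarith
  have hqb : ∀ {u v : ℝ}, |u| ≤ Mp → |v| ≤ Mq → |u - lam * v| ≤ Q * N ^ 2 := by
    intro u v hu hv
    have h1 : |lam * v| ≤ C₂ * N ^ 2 * Mq := by
      rw [abs_mul, abs_of_nonneg hlam]
      exact mul_le_mul hlamN hv (abs_nonneg _) (by positivity)
    have h2 : Mp ≤ Mp * N ^ 2 := le_mul_of_one_le_right hMp.le (one_le_pow₀ hN)
    calc |u - lam * v| ≤ |u| + |lam * v| := abs_sub _ _
      _ ≤ Mp * N ^ 2 + C₂ * N ^ 2 * Mq := by linarith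
      _ = Q * N ^ 2 := by rw [hQ]; ring
  -- Bookkeeping by powers of `N`: the coefficient containing `lam` has order 2, and `N ≥ 1` lets
  -- lower powers be raised.
  have hmul : ∀ {u v A B : ℝ} {i j : ℕ} (k : ℕ), |u| ≤ A * N ^ i → |v| ≤ B * N ^ j → 0 ≤ A → 0 ≤ B →
      i + j ≤ k → |u * v| ≤ A * B * N ^ k := by
    intro u v A B i j k hu hv hA hB hk
    rw [abs_mul]
    calc |u| * |v| ≤ (A * N ^ i) * (B * N ^ j) := by gcongr
      _ = A * B * N ^ (i + j) := by ring
      _ ≤ A * B * N ^ k := by gcongr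
  set Q₀ := fun x => p x - lam * q x with hQ₀
  set Q₁ := fun x => p₁ x - lam * q₁ x
  set Q₂ := fun x => p₂ x - lam * q₂ x
  have hQd : ∀ x ∈ Icc l r, HasDerivWithinAt Q₀ (Q₁ x) (Icc l r) x := fun x hx =>
    (hp₁ x hx).sub ((hq₁ x hx).const_mul lam)
  have hQd' : ∀ x ∈ Icc l r, HasDerivWithinAt Q₁ (Q₂ x) (Icc l r) x := fun x hx =>
    (hp₂ x hx).sub ((hq₂ x hx).const_mul lam)
  have hQc : ContinuousOn Q₂ (Icc l r) := hpc.sub (continuousOn_const.mul hqc)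
  have hQb₀ : ∀ x ∈ Icc l r, |Q₀ x| ≤ Q * N ^ 2 := fun x hx => hqb (hMp' x hx).1 (hMq' x hx).1
  have hQb₁ : ∀ x ∈ Icc l r, |Q₁ x| ≤ Q * N ^ 2 := fun x hx => hqb (hMp' x hx).2.1 (hMq' x hx).2.1
  have hQb₂ : ∀ x ∈ Icc l r, |Q₂ x| ≤ Q * N ^ 2 := fun x hx => hqb (hMp' x hx).2.2 (hMq' x hx).2.2
  set φ₂ := fun x => a x * φ₁ x + Q₀ x * φ x with hφ₂
  set φ₃ := fun x => a₁ x * φ₁ x + a x * φ₂ x + (Q₁ x * φ x + Q₀ x * φ₁ x) with hφ₃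
  set φ₄ := fun x => a₂ x * φ₁ x + 2 * (a₁ x * φ₂ x) + a x * φ₃ x +
    (Q₂ x * φ x + 2 * (Q₁ x * φ₁ x) + Q₀ x * φ₂ x) with hφ₄
  have h₃ : ∀ x ∈ Icc l r, HasDerivWithinAt φ₂ (φ₃ x) (Icc l r) x := fun x hx =>
    ((ha₁ x hx).mul (h₂ x hx)).add ((hQd x hx).mul (h₁ x hx))
  have h₄ : ∀ x ∈ Icc l r, HasDerivWithinAt φ₃ (φ₄ x) (Icc l r) x := fun x hx => by
    refine ((((ha₂ x hx).mul (h₂ x hx)).add ((ha₁ x hx).mul (h₃ x hx))).add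
      (((hQd' x hx).mul (h₁ x hx)).add ((hQd x hx).mul (h₂ x hx)))).congr_deriv ?_
    simp only [hφ₄, hφ₂]
    ring
  have hc : ∀ {f f' : ℝ → ℝ}, (∀ x ∈ Icc l r, HasDerivWithinAt f (f' x) (Icc l r) x) →
      ContinuousOn f (Icc l r) := fun h x hx => (h x hx).continuousWithinAt
  have hφ₄c : ContinuousOn φ₄ (Icc l r) :=
    (((hac.mul (hc h₂)).add (continuousOn_const.mul ((hc ha₂).mul (hc h₃)))).add
      (ha.continuousOn.mul (hc h₄))).add (((hQc.mul (hc h₁)).add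
        (continuousOn_const.mul ((hc hQd').mul (hc h₂)))).add ((hc hQd).mul (hc h₃)))
  have hb₀' : ∀ x ∈ Icc l r, |φ x| ≤ C * N ^ 0 := by simpa using hb₀
  have hb₁' : ∀ x ∈ Icc l r, |φ₁ x| ≤ C * N ^ 1 := by simpa using hb₁
  have hA₀ : ∀ x ∈ Icc l r, |a x| ≤ Ma * N ^ 0 := fun x hx => by simpa using (hMa' x hx).1
  have hA₁ : ∀ x ∈ Icc l r, |a₁ x| ≤ Ma * N ^ 0 := fun x hx => by simpa using (hMa' x hx).2.1
  have hA₂ : ∀ x ∈ Icc l r, |a₂ x| ≤ Ma * N ^ 0 := fun x hx => by simpa using (hMa' x hx).2.2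
  have hK₂0 : 0 ≤ K₂ := by positivity
  have hK₃0 : 0 ≤ K₃ := by positivity
  have hK₄0 : 0 ≤ K₄ := by positivity
  have hb₂ : ∀ x ∈ Icc l r, |φ₂ x| ≤ K₂ * N ^ 2 := fun x hx => by
    have e1 := hmul 2 (hA₀ x hx) (hb₁' x hx) hMa.le hC (by norm_num)
    have e2 := hmul 2 (hQb₀ x hx) (hb₀' x hx) hQ0 hC (by norm_num)
    refine (abs_add_le _ _).trans ?_
    rw [hK₂]
    linarith
  have hb₃ : ∀ x ∈ Icc l r, |φ₃ x| ≤ K₃ * N ^ 3 := fun x hx => by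
    have e1 := hmul 3 (hA₁ x hx) (hb₁' x hx) hMa.le hC (by norm_num)
    have e2 := hmul 3 (hA₀ x hx) (hb₂ x hx) hMa.le hK₂0 (by norm_num)
    have e3 := hmul 3 (hQb₁ x hx) (hb₀' x hx) hQ0 hC (by norm_num)
    have e4 := hmul 3 (hQb₀ x hx) (hb₁' x hx) hQ0 hC (by norm_num)
    refine (abs_add_le _ _).trans ((add_le_add (abs_add_le _ _) (abs_add_le _ _)).trans ?_)
    rw [hK₃]
    linarith
  have hb₄ : ∀ x ∈ Icc l r, |φ₄ x| ≤ K₄ * N ^ 4 := fun x hx => by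
    have e1 := hmul 4 (hA₂ x hx) (hb₁' x hx) hMa.le hC (by norm_num)
    have e2 := hmul 4 (hA₁ x hx) (hb₂ x hx) hMa.le hK₂0 (by norm_num)
    have e3 := hmul 4 (hA₀ x hx) (hb₃ x hx) hMa.le hK₃0 (by norm_num)
    have e4 := hmul 4 (hQb₂ x hx) (hb₀' x hx) hQ0 hC (by norm_num)
    have e5 := hmul 4 (hQb₁ x hx) (hb₁' x hx) hQ0 hC (by norm_num)
    have e6 := hmul 4 (hQb₀ x hx) (hb₂ x hx) hQ0 hK₂0 (by norm_num)
    refine (abs_add_le _ _).trans ((add_le_add ((abs_add_le _ _).trans (add_le_add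
      (abs_add_le _ _) le_rfl)) ((abs_add_le _ _).trans (add_le_add
      (abs_add_le _ _) le_rfl))).trans ?_)
    rw [abs_mul 2, abs_mul 2, abs_two, hK₄]
    linarith
  let F : ℕ → ℝ → ℝ
    | 0 => φ
    | 1 => φ₁
    | 2 => φ₂
    | 3 => φ₃
    | _ => φ₄
  have hF : ∀ i < 4, ∀ x ∈ Icc l r, HasDerivWithinAt (F i) (F (i + 1) x) (Icc l r) x := by
    intro i hi
    interval_cases i
    exacts [h₁, h₂, h₃, h₄]
  refine ⟨contDiffOn_of_hasDerivWithinAt_chain hu 4 hF hφ₄c, fun i hi x hx => ?_⟩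
  have he : iteratedDerivWithin i φ (Icc l r) x = F i x :=
    iteratedDerivWithin_eqOn_of_hasDerivWithinAt hu 4 hF i hi hx
  rw [he]
  have hw : ∀ {y A : ℝ}, |y| ≤ A * N ^ i → A ≤ 1 + C + K₂ + K₃ + K₄ →
      |y| ≤ (1 + C + K₂ + K₃ + K₄) * N ^ i := fun h h' => h.trans (by gcongr)
  interval_cases i
  · exact hw (hb₀' x hx) (by linarith)
  · exact hw (hb₁' x hx) (by linarith)
  · exact hw (hb₂ x hx) (by linarith)
  · exact hw (hb₃ x hx) (by linarith)
  · exact hw (hb₄ x hx) (by linarith)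

/-! ### Assembly of the theorem -/

/-- The `k`-th eigenvalue (`k = 1, 2, …`) is `lam (k - 1)`, written below as `lam n` with
`k = n + 1`; `lam` is determined by the first two conjuncts. -/
theorem proposition2p3
    (l r ρ : ℝ) (hlr : l < r) (hρ : 0 < ρ)
    (μ σ κ : ℝ → ℝ)
    (hμ : ContDiffOn ℝ 3 μ (Set.Icc l r))
    (hσ : ContDiffOn ℝ 4 (fun x => σ x ^ 2) (Set.Icc l r))
    (hσpos : ∀ x ∈ Set.Icc l r, 0 < σ x ^ 2)
    (hκ : ContDiffOn ℝ 2 κ (Set.Icc l r))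
    (hκnonneg : ∀ x ∈ Set.Icc l r, 0 ≤ κ x) :
    ∃ lam : ℕ → ℝ,
      StrictMono lam ∧
      Set.range lam = stickyEigenvalues l r ρ μ σ κ ∧
      -- every eigenvalue is simple
      (∀ (n : ℕ) (φ ψ : ℝ → ℝ),
        IsStickyEigenfunction l r ρ μ σ κ (lam n) φ →
        IsStickyEigenfunction l r ρ μ σ κ (lam n) ψ →
        ∃ c : ℝ, ∀ x ∈ Set.Icc l r, ψ x = c * φ x) ∧
      ∃ C₁ C₂ C₃ : ℝ, 0 < C₁ ∧ 0 < C₂ ∧ 0 < C₃ ∧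
        (∀ n : ℕ, C₁ * ((n : ℝ) + 1) ^ 2 ≤ lam n ∧ lam n ≤ C₂ * ((n : ℝ) + 1) ^ 2) ∧
        (∀ (n : ℕ) (φ : ℝ → ℝ),
          IsStickyEigenfunction l r ρ μ σ κ (lam n) φ →
          speedInner l r ρ μ σ φ φ = 1 →
          ContDiffOn ℝ 4 φ (Set.Icc l r) ∧
          ∀ i ∈ Finset.range 5, ∀ x ∈ Set.Icc l r,
            |iteratedDerivWithin i φ (Set.Icc l r) x| ≤ C₃ * ((n : ℝ) + 1) ^ i) := by
  have hμc := hμ.continuousOn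
  have hσc := hσ.continuousOn
  have hκc := hκ.continuousOn
  have hl : l ∈ Set.Icc l r := Set.left_mem_Icc.2 hlr.le
  have hs : ContinuousOn (scaleDensity l μ σ) (Set.Icc l r) := fun x hx =>
    (hasDerivWithinAt_scaleDensity hlr.le hμc hσc hσpos x hx).continuousWithinAt
  have hm := continuousOn_speedDensity hs hσc hσpos
  choose Θ hΘ using IsPruferAngle.exists_angle (ρ := ρ) hlr.le hs hm hκc
  choose R hR hRmul hRsol using fun lam => (hΘ lam).exists_radius hlr hρ hμc hσc hσpos hκc
  obtain ⟨lam, hmono, hrange, hpos, C₁, C₂, hC₁, hC₂, hlam⟩ := IsPruferAngle.exists_spectrum hlr hρ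
    hs hm hκc (fun x _ => scaleDensity_pos l μ σ x) (fun x hx => speedDensity_pos (hσpos x hx))
    hκnonneg hΘ
  obtain ⟨B, hB, hB'⟩ := exists_energy_bound hlr hρ (hpos 0) hμc (hσ.of_le (by norm_num)) hσpos hκc
    hκnonneg
  have hσ2 : ContDiffOn ℝ 2 (fun x => σ x ^ 2) (Set.Icc l r) := hσ.of_le (by norm_num)
  have hσne : ∀ x ∈ Set.Icc l r, σ x ^ 2 ≠ 0 := fun x hx => (hσpos x hx).ne'
  -- `√B` bounds `|φ|`, and `φ'² ≤ B lam ≤ B C₂ (n + 1)²` accounts for `√(B * C₂)`.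
  obtain ⟨C₃, hC₃, hC₃'⟩ := exists_derivative_bounds (C := √B + √(B * C₂)) (C₂ := C₂)
    (a := fun x => -(2 * μ x) / σ x ^ 2) (p := fun x => 2 * κ x / σ x ^ 2)
    (q := fun x => 2 / σ x ^ 2) hlr (by positivity) hC₂.le
    (((contDiffOn_const.mul (hμ.of_le (by norm_num))).neg).div hσ2 hσne)
    ((contDiffOn_const.mul hκ).div hσ2 hσne) (contDiffOn_const.div hσ2 hσne)
  refine ⟨lam, hmono, ?_, fun n φ ψ hφ hψ => ?_, C₁, C₂, C₃, hC₁, hC₂, hC₃, hlam,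
    fun n φ hφ hn => ?_⟩
  · rw [hrange]
    ext t
    constructor
    · intro ht
      -- Nontriviality is seen at `l`, where the angle lies strictly between `0` and `π`.
      refine ⟨_, hRsol t ht, l, hl, (mul_pos (hR t l) ?_).ne'⟩
      exact Real.sin_pos_of_pos_of_lt_pi (hΘ t).init_mem.1 (hΘ t).init_mem.2
    · rintro ⟨φ, hφ, x, hx, hne⟩
      obtain ⟨c, hc⟩ := hRmul t φ hφ
      have h0 := hc r (Set.right_mem_Icc.2 hlr.le)
      rw [hφ.right_bc] at h0
      have hc0 : c ≠ 0 := by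
        rintro rfl
        exact hne (by rw [hc x hx, zero_mul])
      exact ((mul_eq_zero.1 ((mul_eq_zero.1 h0.symm).resolve_left hc0)).resolve_left (hR t r).ne')
  · obtain ⟨c, hc⟩ := hRmul _ φ hφ.1
    obtain ⟨d, hd⟩ := hRmul _ ψ hψ.1
    obtain ⟨x, hx, hne⟩ := hφ.2
    have hc0 : c ≠ 0 := by
      rintro rfl
      exact hne (by rw [hc x hx, zero_mul])
    exact ⟨d / c, fun y hy => by rw [hc y hy, hd y hy]; field_simp⟩
  · have hN : (1 : ℝ) ≤ (n : ℝ) + 1 := le_add_of_nonneg_left n.cast_nonneg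
    have hb := hB' (lam n) φ (hmono.monotone n.zero_le) hφ.1 hn
    obtain ⟨h4, hi⟩ := hC₃' (lam n) (n + 1) φ _ hN (hpos n).le (hlam n).2
      (hφ.1.hasDerivWithinAt hlr) (fun x hx =>
        (hφ.1.hasDerivWithinAt_derivWithin hlr hμc hσc hσpos hκc x hx).congr_deriv (by ring))
      (fun x hx => (Real.abs_le_sqrt (hb x hx).1).trans
        (le_add_of_nonneg_right (Real.sqrt_nonneg _)))
      (fun x hx => by
        have h1 : derivWithin φ (Set.Icc l r) x ^ 2 ≤ B * C₂ * ((n : ℝ) + 1) ^ 2 := by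
          have := mul_le_mul_of_nonneg_left (hlam n).2 hB.le
          linarith [(hb x hx).2]
        have h2 := Real.abs_le_sqrt h1
        rw [Real.sqrt_mul (by positivity), Real.sqrt_sq (by linarith)] at h2
        nlinarith [Real.sqrt_nonneg B])
    exact ⟨h4, fun i hi' => hi i (Nat.lt_succ_iff.1 (Finset.mem_range.1 hi'))⟩
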